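/- Fix a constant $d\ge 1$. A multi-objective mixed-integer linear program (MOMILP) with $d$ objectives is a problem $\min f(x)=Qx$ subject to $Ax\ge b$, $x\in\mathbb R^{n_{\mathbb R}}\times\mathbb Z^{n_{\mathbb Z}}$, with rational data; $X$ denotes its feasible set. Consider a family of MOMILP instances $I$ with $X\neq\emptyset$ and $f(x)\in\mathbb R^d_{\ge 0}$ for all $x\in X$, each encoded by its objective matrix $Q$ and some description of its constraints; $\langle\cdot\rangle$ denotes binary encoding length, and running times are bit costs. For $\varepsilon>0$, a set $R\subseteq X$ is a $(1+\varepsilon)$-convex approximation set if for every $x\in X$ there is $v\in\operatorname{conv}\{f(x^*):x^*\in R\}$ with $v\le(1+\varepsilon)f(x)$. Let $\mathsf{WS}$ be an algorithm that, for every instance $I$ and every rational weight $w\in\mathbb Q^d_{\ge 0}$, returns a rational optimal solution of $\min_{x\in X} w^{\mathsf T}f(x)$ in time polynomial in $\langle I\rangle$ and $\langle w\rangle$, where the returned solutions have encoding length polynomial in $\langle I\rangle$. The oracle $\mathsf{hpO\text{-}WS}$, called for a halfspace $\{z: w^{\mathsf T}z\ge c\}$, computes $x^*=\mathsf{WS}(w)$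 and returns "inside" if $w^{\mathsf T}f(x^*)\ge c$ and $(\text{not inside},x^*)$ otherwise. The inner approximation algorithm with accuracy $\varepsilon\in\mathbb Q_{>0}$ starts with $R=\{x^{\mathrm{init}}\}$ for some rational $x^{\mathrm{init}}\in X$ and $F=\emptyset$. While the polyhedron $\mathcal A_R=\operatorname{conv}\{f(x):x\in R\}+\mathbb R^d_{\ge0}$ has a facet-supporting halfspace not in $F$, it picks an arbitrary such $H=\{z:w^{\mathsf T}z\ge c\}$ (with $w,c$ rational) and calls the oracle for $\{z:(1+\varepsilon)w^{\mathsf T}z\ge c\}$; if a solution $x^*$ is returned, $x^*$ is added to $R$, otherwise $H$ is added to $F$. The set $R$ at termination is the output. Then the inner approximation algorithm with the oracle $\mathsf{hpO\text{-}WS}$ is a multi-objective convex fully polynomial-time approximation scheme (cFPTAS): 1. For every instance $I$, every $\varepsilon\in\mathbb Q_{>0}$, every rational $x^{\mathrm{init}}\in X$ and every choice of the halfspaces, it terminates after a number of iterations polynomial in $\langle I\rangle$ and $\varepsilon^{-1}$, and its output is a $(1+\varepsilon)$-convex approximation set. 2. There is a single program which, on input $(I,\varepsilon)$ with $\varepsilon\in\mathbb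 Q_{>0}$, finds some initial solution, outputs the result of a complete run of the algorithm from it, which is a $(1+\varepsilon)$-convex approximation set, and runs in time polynomial in the input length $\langle I\rangle+\langle\varepsilon\rangle$ and $\varepsilon^{-1}$. -/

import Mathlib

open scoped Pointwise Matrix

/-! ## A machine model with bit costs -/

/-- The data on which programs work: binary trees with integer leaves. -/
inductive BData where
  | int (z : ℤ)
  | pair (a b : BData)

namespace BData

/-- Binary encoding length: each integer is counted with its number of bits. -/
def size : BData → ℕ
  | int z => Nat.size z.natAbs + 1
  | pair a b => a.size + b.size + 1

/-- The integer stored at a leaf (and `0` for a pair). -/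
def toInt : BData → ℤ
  | int z => z
  | pair _ _ => 0

def left : BData → BData
  | int _ => int 0
  | pair a _ => a

def right : BData → BData
  | int _ => int 0
  | pair _ b => b

/-- `1` for a pair, `0` for a leaf. -/
def isPair : BData → BData
  | int _ => int 0
  | pair _ _ => int 1

/-- Lists are nested pairs that end in the leaf `0`. -/
def ofList : List BData → BData
  | [] => int 0
  | a :: l => pair a (ofList l)

/-- Reduced fraction, numerator and denominator in binary. -/
def ofRat (q : ℚ) : BData := pair (int q.num) (int q.den)

def ofVec {n : ℕ} (v : Fin n → ℚ) : BData := ofList (List.ofFn fun k => ofRat (v k))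

/-- A matrix is encoded as the list of its rows. -/
def ofMat {m n : ℕ} (M : Matrix (Fin m) (Fin n) ℚ) : BData :=
  ofList (List.ofFn fun j => ofVec (M j))

end BData

/-- Elementary operations; the arithmetic ones act on a pair of two integer leaves. -/
inductive PrimOp where
  | ident
  | const (z : ℤ)
  | left
  | right
  | isPair
  | add
  | sub
  | mul
  | div
  | le

def PrimOp.apply : PrimOp → BData → BData
  | ident, x => x
  | const z, _ => .int z
  | left, x => x.left
  | right, x => x.right
  | isPair, x => x.isPair
  | add, x => .int (x.left.toInt + x.right.toInt)
  | sub, x => .int (x.left.toInt - x.right.toInt)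
  | mul, x => .int (x.left.toInt * x.right.toInt)
  | div, x => .int (x.left.toInt / x.right.toInt)
  | le, x => .int (if x.left.toInt ≤ x.right.toInt then 1 else 0)

/-- Programs of a while-language on `BData`. A program transforms an input into an output. -/
inductive Prog where
  /-- an elementary operation -/
  | prim (o : PrimOp)
  /-- run both programs on the input and pair the two outputs -/
  | both (p q : Prog)
  /-- run `p`, then run `q` on the output of `p` -/
  | seq (p q : Prog)
  /-- run `p` or `q` on the input, according to whether the test `b` gives a nonzero integer -/
  | cond (b p q : Prog)
  /-- while the test `b` gives a nonzero integer, replace the current value by the output of `p` -/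
  | loop (b p : Prog)

/-- `Prog.Runs p x y t`: on input `x` the program `p` halts with output `y` after `t` steps.
Every elementary operation is charged the bit length of the data that it reads and writes, and
every copy of a value is charged its bit length. All elementary operations are computable in
polynomial time in the bit lengths, and Turing machines are simulated step by step, so that
polynomial time in this model is polynomial time on Turing machines. -/
inductive Prog.Runs : Prog → BData → BData → ℕ → Prop where
  | prim (o : PrimOp) (x : BData) :
      Runs (.prim o) x (o.apply x) (1 + x.size + (o.apply x).size)
  | both {p q : Prog} {x y z : BData} {s t : ℕ} :
      Runs p x y s → Runs q x z t → Runs (.both p q) x (.pair y z) (1 + x.size + s + t)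
  | seq {p q : Prog} {x y z : BData} {s t : ℕ} :
      Runs p x y s → Runs q y z t → Runs (.seq p q) x z (1 + s + t)
  | condTrue {b p q : Prog} {x r y : BData} {s t : ℕ} :
      Runs b x r s → r.toInt ≠ 0 → Runs p x y t → Runs (.cond b p q) x y (1 + x.size + s + t)
  | condFalse {b p q : Prog} {x r y : BData} {s t : ℕ} :
      Runs b x r s → r.toInt = 0 → Runs q x y t → Runs (.cond b p q) x y (1 + x.size + s + t)
  | loopDone {b p : Prog} {x r : BData} {s : ℕ} :
      Runs b x r s → r.toInt = 0 → Runs (.loop b p) x x (1 + x.size + s)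
  | loopStep {b p : Prog} {x r y z : BData} {s t u : ℕ} :
      Runs b x r s → r.toInt ≠ 0 → Runs p x y t → Runs (.loop b p) y z u →
        Runs (.loop b p) x z (1 + x.size + s + t + u)

/-- On input `x` the program halts with output `y` after at most `T` steps. -/
def Prog.RunsWithin (p : Prog) (x y : BData) (T : ℕ) : Prop :=
  ∃ t ≤ T, p.Runs x y t

/-! ## Polyhedra -/

/-- The halfspace `{z | wᵀ z ≥ c}`. -/
def halfspace {d : ℕ} (w : Fin d → ℝ) (c : ℝ) : Set (Fin d → ℝ) := {z | c ≤ w ⬝ᵥ z}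

/-- The boundary `{z | wᵀ z = c}` of `halfspace w c`. -/
def hyperplane {d : ℕ} (w : Fin d → ℝ) (c : ℝ) : Set (Fin d → ℝ) := {z | w ⬝ᵥ z = c}

/-- A face of `P` is `P` itself or its intersection with a hyperplane that bounds a valid
halfspace. -/
def IsFace {d : ℕ} (P F : Set (Fin d → ℝ)) : Prop :=
  F = P ∨ ∃ w c, w ≠ 0 ∧ P ⊆ halfspace w c ∧ F = P ∩ hyperplane w c

/-- A facet is a nonempty face whose dimension is one less than that of `P`. -/
def IsFacet {d : ℕ} (P F : Set (Fin d → ℝ)) : Prop :=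
  IsFace P F ∧ F.Nonempty ∧
    Module.finrank ℝ (vectorSpan ℝ F) + 1 = Module.finrank ℝ (vectorSpan ℝ P)

/-- The set of facet-supporting halfspaces of `P`. -/
def facetHalfspaces {d : ℕ} (P : Set (Fin d → ℝ)) : Set (Set (Fin d → ℝ)) :=
  {H | ∃ w c, w ≠ 0 ∧ H = halfspace w c ∧ P ⊆ H ∧ ∃ F, IsFacet P F ∧ F ⊆ hyperplane w c}

/-! ## Multi-objective mixed-integer linear programs -/

/-- The vector of reals given by a vector of rationals. -/
def castVec {n : ℕ} (x : Fin n → ℚ) : Fin n → ℝ := fun k => (x k : ℝ)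

/-- A multi-objective mixed-integer linear program `min Qx` subject to `Ax ≥ b`,
`x ∈ ℝ^nR × ℤ^nZ`, with `d` objectives and rational data. -/
structure MOMILP (d : ℕ) where
  m : ℕ
  nR : ℕ
  nZ : ℕ
  Q : Matrix (Fin d) (Fin (nR + nZ)) ℚ
  A : Matrix (Fin m) (Fin (nR + nZ)) ℚ
  b : Fin m → ℚ

namespace MOMILP

variable {d : ℕ}

/-- The number of variables. -/
abbrev n (M : MOMILP d) : ℕ := M.nR + M.nZ

/-- The set `X` of feasible solutions. -/
def X (M : MOMILP d) : Set (Fin M.n → ℝ) :=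
  {x | (∀ j, (M.b j : ℝ) ≤ ∑ k, (M.A j k : ℝ) * x k) ∧
    ∀ k : Fin M.nZ, ∃ z : ℤ, x (Fin.natAdd M.nR k) = z}

/-- The objective function `f(x) = Qx`. -/
def f (M : MOMILP d) (x : Fin M.n → ℝ) : Fin d → ℝ := fun j => ∑ k, (M.Q j k : ℝ) * x k

/-- `R` is a `(1+ε)`-convex approximation set. -/
def IsConvexApproxSet (M : MOMILP d) (ε : ℝ) (R : Set (Fin M.n → ℝ)) : Prop :=
  R ⊆ M.X ∧ ∀ x ∈ M.X, ∃ v ∈ convexHull ℝ (M.f '' R), v ≤ (1 + ε) • M.f x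

/-- `x` is an optimal solution of the weighted sum scalarization `min wᵀ f(x)`, `x ∈ X`. -/
def IsWSOptimal (M : MOMILP d) (w : Fin d → ℚ) (x : Fin M.n → ℚ) : Prop :=
  castVec x ∈ M.X ∧ ∀ x' ∈ M.X, castVec w ⬝ᵥ M.f (castVec x) ≤ castVec w ⬝ᵥ M.f x'

/-- The plane separating oracle built from a solver `WS` of the weighted sum scalarization, called
for the halfspace `{z | wᵀ z ≥ c}`. The answer `none` stands for (inside, ∅) and `some x` for
(not inside, x). -/
def hpOWS (M : MOMILP d) (WS : (Fin d → ℚ) → (Fin M.n → ℚ)) (w : Fin d → ℚ) (c : ℚ) :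
    Option (Fin M.n → ℚ) :=
  if c ≤ w ⬝ᵥ (M.Q *ᵥ WS w) then none else some (WS w)

/-! ### The inner approximation algorithm -/

/-- The inner approximation polyhedron `conv {f(x) | x ∈ R} + ℝ^d_{≥0}`. -/
def innerPoly (M : MOMILP d) (R : Finset (Fin M.n → ℚ)) : Set (Fin d → ℝ) :=
  convexHull ℝ ((fun x => M.f (castVec x)) '' (R : Set (Fin M.n → ℚ))) + {z | 0 ≤ z}

/-- The variables of the algorithm: the set `R` of solutions found so far and the set `F` of
halfspaces that are already settled. -/
structure State (M : MOMILP d) where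
  R : Finset (Fin M.n → ℚ)
  F : Set (Set (Fin d → ℝ))

/-- One iteration of the while-loop with the oracle `hpO` and the accuracy `ε`: an arbitrary
facet-supporting halfspace `{z | wᵀ z ≥ c}` that is not in `F` is chosen, in an arbitrary rational
representation, and the oracle is called for `{z | (1+ε) wᵀ z ≥ c}`. -/
inductive Step (M : MOMILP d) (hpO : (Fin d → ℚ) → ℚ → Option (Fin M.n → ℚ)) (ε : ℚ) :
    State M → State M → Prop where
  | notInside {S : State M} {w : Fin d → ℚ} {c : ℚ} {x : Fin M.n → ℚ} :
      halfspace (castVec w) (c : ℝ) ∈ facetHalfspaces (M.innerPoly S.R) \ S.F →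
      hpO ((1 + ε) • w) c = some x →
      Step M hpO ε S ⟨insert x S.R, S.F⟩
  | inside {S : State M} {w : Fin d → ℚ} {c : ℚ} :
      halfspace (castVec w) (c : ℝ) ∈ facetHalfspaces (M.innerPoly S.R) \ S.F →
      hpO ((1 + ε) • w) c = none →
      Step M hpO ε S ⟨S.R, insert (halfspace (castVec w) (c : ℝ)) S.F⟩

/-- `Reaches M hpO ε x₀ k S`: some run of the algorithm that starts with the initial solution `x₀`
is in state `S` after `k` iterations. -/
inductive Reaches (M : MOMILP d) (hpO : (Fin d → ℚ) → ℚ → Option (Fin M.n → ℚ)) (ε : ℚ)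
    (x₀ : Fin M.n → ℚ) : ℕ → State M → Prop where
  | init : Reaches M hpO ε x₀ 0 ⟨{x₀}, ∅⟩
  | step {k : ℕ} {S S' : State M} :
      Reaches M hpO ε x₀ k S → Step M hpO ε S S' → Reaches M hpO ε x₀ (k + 1) S'

/-- The condition under which the while-loop ends. -/
def State.IsFinal {M : MOMILP d} (S : State M) : Prop :=
  facetHalfspaces (M.innerPoly S.R) \ S.F = ∅

end MOMILP

/-! ## Multi-objective problems and their encodings -/

/-- A problem with `d` objectives: a family of feasible MOMILP instances with nonnegative images.
The objective matrix of an instance is part of its encoding; its constraints may be described by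
any data, for example by `A`, `b`, `nR`, `nZ`, or by a graph. -/
structure MOProblem (d : ℕ) where
  Inst : Type
  toMOMILP : Inst → MOMILP d
  /-- the description of the constraints -/
  descr : Inst → BData
  feasible : ∀ I, (toMOMILP I).X.Nonempty
  nonneg : ∀ I, ∀ x ∈ (toMOMILP I).X, 0 ≤ (toMOMILP I).f x

namespace MOProblem

variable {d : ℕ}

/-- The encoding of an instance. -/
def enc (P : MOProblem d) (I : P.Inst) : BData :=
  .pair (BData.ofMat (P.toMOMILP I).Q) (P.descr I)

/-- `WS` solves the weighted sum scalarization of every instance exactly for all weights `w ≥ 0`,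
in time polynomial in `⟨I, w⟩`, and it returns solutions of length polynomial in `⟨I⟩`. -/
def IsPolyTimeWS (P : MOProblem d)
    (WS : ∀ I : P.Inst, (Fin d → ℚ) → (Fin (P.toMOMILP I).n → ℚ)) : Prop :=
  (∀ I w, 0 ≤ w → (P.toMOMILP I).IsWSOptimal w (WS I w)) ∧
  (∃ q : Polynomial ℕ, ∀ I w, 0 ≤ w → (BData.ofVec (WS I w)).size ≤ q.eval (P.enc I).size) ∧
  ∃ (prog : Prog) (p : Polynomial ℕ), ∀ I w, 0 ≤ w →
    prog.RunsWithin (.pair (P.enc I) (BData.ofVec w)) (BData.ofVec (WS I w))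
      (p.eval ((P.enc I).size + (BData.ofVec w).size))

/-- On input `(I, ε)` the program outputs, as a list, the set `R` that is computed by a complete run
of the inner approximation algorithm with the oracle built from `WS` and with accuracy `ε`. -/
def ImplementsInnerApprox (P : MOProblem d)
    (WS : ∀ I : P.Inst, (Fin d → ℚ) → (Fin (P.toMOMILP I).n → ℚ)) (alg : Prog) : Prop :=
  ∀ (I : P.Inst) (ε : ℚ), 0 < ε →
    ∃ (x₀ : Fin (P.toMOMILP I).n → ℚ) (k : ℕ) (S : MOMILP.State (P.toMOMILP I))
      (L : List (Fin (P.toMOMILP I).n → ℚ)) (t : ℕ),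
      castVec x₀ ∈ (P.toMOMILP I).X ∧
      (P.toMOMILP I).Reaches ((P.toMOMILP I).hpOWS (WS I)) ε x₀ k S ∧ S.IsFinal ∧
      (∀ x, x ∈ L ↔ x ∈ S.R) ∧
      alg.Runs (.pair (P.enc I) (BData.ofRat ε)) (BData.ofList (L.map BData.ofVec)) t

/-- The program is a multi-objective convex fully polynomial-time approximation scheme: on input
`(I, ε)` it outputs a `(1+ε)`-convex approximation set in time polynomial in the length of the
input and `1/ε`. -/
def IsCFPTAS (P : MOProblem d) (alg : Prog) : Prop :=
  ∃ p : Polynomial ℕ, ∀ (I : P.Inst) (ε : ℚ), 0 < ε →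
    ∃ L : List (Fin (P.toMOMILP I).n → ℚ),
      (P.toMOMILP I).IsConvexApproxSet ε (castVec '' {x | x ∈ L}) ∧
      alg.RunsWithin (.pair (P.enc I) (BData.ofRat ε)) (BData.ofList (L.map BData.ofVec))
        (p.eval ((P.enc I).size + (BData.ofRat ε).size + ⌈ε⁻¹⌉₊))

/-- Every run of the inner approximation algorithm with the oracle built from `WS`, from every
initial solution and for all choices of halfspaces, ends after a number of iterations that is
polynomial in `⟨I⟩` and `1/ε`, without getting stuck, with a `(1+ε)`-convex approximation set. -/
def AllRunsSucceed (P : MOProblem d)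
    (WS : ∀ I : P.Inst, (Fin d → ℚ) → (Fin (P.toMOMILP I).n → ℚ)) : Prop :=
  ∃ p : Polynomial ℕ, ∀ (I : P.Inst) (ε : ℚ), 0 < ε →
    ∀ x₀ : Fin (P.toMOMILP I).n → ℚ, castVec x₀ ∈ (P.toMOMILP I).X →
    ∀ (k : ℕ) (S : MOMILP.State (P.toMOMILP I)),
      (P.toMOMILP I).Reaches ((P.toMOMILP I).hpOWS (WS I)) ε x₀ k S →
      k ≤ p.eval ((P.enc I).size + ⌈ε⁻¹⌉₊) ∧
      (S.IsFinal →
        (P.toMOMILP I).IsConvexApproxSet ε (castVec '' (S.R : Set (Fin (P.toMOMILP I).n → ℚ)))) ∧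
      (¬ S.IsFinal →
        ∃ S', (P.toMOMILP I).Step ((P.toMOMILP I).hpOWS (WS I)) ε S S')

end MOProblem

/-! ## Polynomial bounds -/

/-! Every iteration enlarges either `R` or `F`, so it suffices to bound both. Suppose the oracle
rejects `H = {w·z ≥ c}` with a solution `x`. Then `(1+ε) w·f(x) < c ≤ w·f(y)` for all `y ∈ R`, and
since facet normals of `A_R` are nonnegative, `f(y) ≤ (1+ε) f(x)` fails for each of them. Solutions
returned by `WS` have encoding length polynomial in `⟨I⟩`, so every objective value is zero or lies
between `2^(-E)` and `2^E` with `E` polynomial. Cover this range by intervals of ratio `1+ε`; the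
resulting grid has polynomially many boxes because `d` is fixed, and each box contains at most one
solution of `R` other than `x₀` (`RunInv.card_R_le`).

To bound `F`, pass to homogeneous coordinates: the boundary of a facet halfspace is spanned by `d`
generators, which are images of solutions or unit directions, and its normal is their generalized
cross product up to sign and positive scaling (`facetHalfspaces_subset`). This leaves at most `2
(|R|+d)^d` halfspaces (`finite_candidates`).

At termination all facet halfspaces lie in `F`, so each contains `(1+ε) f(x)` for every `x ∈ X`. As
`A_R` is the intersection of its facet halfspaces (`mem_upperHull_of_forall_facet`), `(1+ε) f(x) ∈
A_R`, which is the approximation property.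

The program starts from `WS 0` and stores no `F`. It enumerates all `d`-tuples of generators with
both signs, discards normals that are zero or not valid, and queries the oracle for the others. A
rejection is an iteration of the algorithm (`search_step`). If there is none, all facets would be
accepted (`search_eq_none`), so the abstract run can be completed without changing `R`. The
iteration bound therefore also bounds the number of searches. Integer arithmetic and the uniform
length bound on solutions of `WS` keep every intermediate value polynomially long. -/

theorem Polynomial.eval_mono_nat (p : Polynomial ℕ) {m n : ℕ} (h : m ≤ n) :
    p.eval m ≤ p.eval n := by
  simp only [Polynomial.eval_eq_sum_range]
  gcongr

/-- `f` is bounded by a polynomial in `s`. -/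
def PolyBdd {κ : Type*} (s f : κ → ℕ) : Prop :=
  ∃ p : Polynomial ℕ, ∀ k, f k ≤ p.eval (s k)

namespace PolyBdd

variable {κ : Type*} {s f g : κ → ℕ}

theorem mono (hg : PolyBdd s g) (h : ∀ k, f k ≤ g k) : PolyBdd s f := by
  obtain ⟨p, hp⟩ := hg
  exact ⟨p, fun k => (h k).trans (hp k)⟩

theorem self : PolyBdd s s := ⟨Polynomial.X, fun k => by simp⟩

theorem const (c : ℕ) : PolyBdd s fun _ => c := ⟨Polynomial.C c, fun k => by simp⟩

theorem add (hf : PolyBdd s f) (hg : PolyBdd s g) : PolyBdd s fun k => f k + g k := by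
  obtain ⟨p, hp⟩ := hf
  obtain ⟨q, hq⟩ := hg
  exact ⟨p + q, fun k => by simpa using add_le_add (hp k) (hq k)⟩

theorem mul (hf : PolyBdd s f) (hg : PolyBdd s g) : PolyBdd s fun k => f k * g k := by
  obtain ⟨p, hp⟩ := hf
  obtain ⟨q, hq⟩ := hg
  exact ⟨p * q, fun k => by simpa using Nat.mul_le_mul (hp k) (hq k)⟩

theorem pow (hf : PolyBdd s f) (n : ℕ) : PolyBdd s fun k => f k ^ n := by
  obtain ⟨p, hp⟩ := hf
  exact ⟨p ^ n, fun k => by simpa using Nat.pow_le_pow_left (hp k) n⟩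

theorem eval (hf : PolyBdd s f) (p : Polynomial ℕ) : PolyBdd s fun k => p.eval (f k) := by
  obtain ⟨q, hq⟩ := hf
  exact ⟨p.comp q, fun k => by simpa using p.eval_mono_nat (hq k)⟩

theorem reindex {κ' : Type*} (hf : PolyBdd s f) (φ : κ' → κ) :
    PolyBdd (fun k => s (φ k)) fun k => f (φ k) := by
  obtain ⟨p, hp⟩ := hf
  exact ⟨p, fun k => hp _⟩

end PolyBdd

/-! ## Sizes of data -/

namespace BData

theorem size_toInt (x : BData) : Nat.size x.toInt.natAbs + 1 ≤ x.size := by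
  cases x <;> simp [size, toInt]

theorem size_left_add_size_right (x : BData) : x.left.size + x.right.size ≤ x.size + 1 := by
  cases x with
  | int z => simp [size, left, right]
  | pair x y => simp only [size, left, right]; omega

@[simp] theorem left_pair (x y : BData) : (pair x y).left = x := rfl

@[simp] theorem right_pair (x y : BData) : (pair x y).right = y := rfl

theorem size_pair (x y : BData) : (pair x y).size = x.size + y.size + 1 := rfl

theorem size_le_size_ofList {x : BData} {l : List BData} (h : x ∈ l) :
    x.size ≤ (ofList l).size := by
  induction l with
  | nil => simp at h
  | cons a l ih =>
    rcases List.mem_cons.1 h with rfl | h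
    · simp only [ofList, size]; omega
    · have := ih h; simp only [ofList, size]; omega

theorem length_le_size_ofList (l : List BData) : l.length ≤ (ofList l).size := by
  induction l with
  | nil => simp
  | cons a l ih => simp only [ofList, size, List.length_cons]; omega

theorem size_ofList_drop_le (l : List BData) (i : ℕ) :
    (ofList (l.drop i)).size ≤ (ofList l).size := by
  induction l generalizing i with
  | nil => simp
  | cons a l ih =>
    cases i with
    | zero => simp
    | succ i => have := ih i; simp only [List.drop_succ_cons, ofList, size]; omega

theorem size_ofList_le {l : List BData} {B : ℕ} (h : ∀ x ∈ l, x.size ≤ B) :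
    (ofList l).size ≤ l.length * (B + 1) + 1 := by
  induction l with
  | nil => simp [ofList, size]
  | cons a l ih =>
    have h1 := ih fun x hx => h x (List.mem_cons_of_mem _ hx)
    have h2 := h a List.mem_cons_self
    simp only [ofList, size, List.length_cons, add_mul]
    omega

/-- Truth values as data. -/
def bit (c : Prop) [Decidable c] : BData := int (if c then 1 else 0)

/-- Optional values as data. -/
def ofOption : Option BData → BData
  | none => int 0
  | some x => pair x (int 0)

/-- A vector of integers is encoded as a list. -/
def ofIntVec {n : ℕ} (v : Fin n → ℤ) : BData := ofList (List.ofFn fun k => int (v k))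

end BData

theorem Nat.size_mul_le (a b : ℕ) : Nat.size (a * b) ≤ Nat.size a + Nat.size b := by
  rw [Nat.size_le, pow_add]
  exact Nat.mul_lt_mul'' (Nat.lt_size_self a) (Nat.lt_size_self b)

theorem Nat.size_add_le (a b : ℕ) : Nat.size (a + b) ≤ Nat.size a + Nat.size b + 1 := by
  rw [Nat.size_le, pow_succ, pow_add]
  have h1 := Nat.lt_size_self a
  have h2 := Nat.lt_size_self b
  have h3 : 0 < 2 ^ Nat.size a := by positivity
  have h4 : 0 < 2 ^ Nat.size b := by positivity
  nlinarith

/-! ## Polynomial-time computability of families of data -/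

/-- Reading and writing are charged, so a time bound is also a size bound. Hence the size of a value
computed in polynomial time never needs a separate estimate. -/
theorem Prog.Runs.size_le {p : Prog} {x y : BData} {t : ℕ} (h : p.Runs x y t) :
    x.size ≤ t ∧ y.size ≤ t := by
  induction h with
  | prim o x => omega
  | both _ _ ih₁ ih₂ => simp only [BData.size]; omega
  | seq _ _ ih₁ ih₂ => omega
  | condTrue _ _ _ ih₁ ih₂ => omega
  | condFalse _ _ _ ih₁ ih₂ => omega
  | loopDone _ _ ih => omega
  | loopStep _ _ _ _ ih₁ ih₂ ih₃ => omega

/-- One program computes `b k` from `a k`, for all `k`, in time polynomial in `s k`. -/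
def PolyTime {κ : Type*} (s : κ → ℕ) (a b : κ → BData) : Prop :=
  ∃ (prog : Prog) (p : Polynomial ℕ), ∀ k, prog.RunsWithin (a k) (b k) (p.eval (s k))

namespace PolyTime

variable {κ : Type*} {s : κ → ℕ} {a b c : κ → BData}

theorem bdd_left (h : PolyTime s a b) : PolyBdd s fun k => (a k).size := by
  obtain ⟨prog, p, h⟩ := h
  refine ⟨p, fun k => ?_⟩
  obtain ⟨t, ht, hr⟩ := h k
  exact hr.size_le.1.trans ht

theorem bdd_right (h : PolyTime s a b) : PolyBdd s fun k => (b k).size := by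
  obtain ⟨prog, p, h⟩ := h
  refine ⟨p, fun k => ?_⟩
  obtain ⟨t, ht, hr⟩ := h k
  exact hr.size_le.2.trans ht

theorem of_bdd {prog : Prog} {T : κ → ℕ} (hT : PolyBdd s T)
    (h : ∀ k, prog.RunsWithin (a k) (b k) (T k)) : PolyTime s a b := by
  obtain ⟨p, hp⟩ := hT
  refine ⟨prog, p, fun k => ?_⟩
  obtain ⟨t, ht, hr⟩ := h k
  exact ⟨t, ht.trans (hp k), hr⟩

theorem reindex {κ' : Type*} (h : PolyTime s a b) (φ : κ' → κ) :
    PolyTime (fun k => s (φ k)) (fun k => a (φ k)) fun k => b (φ k) := by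
  obtain ⟨prog, p, h⟩ := h
  exact ⟨prog, p, fun k => h _⟩

/-- Both times are measured in the fixed parameter `s k` and not in the size of the current data, so
the two polynomials are added rather than composed. -/
theorem trans (h₁ : PolyTime s a b) (h₂ : PolyTime s b c) : PolyTime s a c := by
  obtain ⟨P, p, hp⟩ := h₁
  obtain ⟨Q, q, hq⟩ := h₂
  refine ⟨.seq P Q, 1 + p + q, fun k => ?_⟩
  obtain ⟨t, ht, hr⟩ := hp k
  obtain ⟨u, hu, hr'⟩ := hq k
  exact ⟨_, by simp only [Polynomial.eval_add, Polynomial.eval_one]; omega, hr.seq hr'⟩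

theorem pair (h₁ : PolyTime s a b) (h₂ : PolyTime s a c) :
    PolyTime s a fun k => .pair (b k) (c k) := by
  have ha := h₁.bdd_left
  obtain ⟨P, p, hp⟩ := h₁
  obtain ⟨Q, q, hq⟩ := h₂
  refine of_bdd (prog := .both P Q) ((((PolyBdd.const 1).add ha).add (PolyBdd.self.eval p)).add
    (PolyBdd.self.eval q)) fun k => ?_
  obtain ⟨t, ht, hr⟩ := hp k
  obtain ⟨u, hu, hr'⟩ := hq k
  exact ⟨_, by omega, hr.both hr'⟩

theorem prim_apply (o : PrimOp) (C : ℕ) (ho : ∀ x, (o.apply x).size ≤ 2 * x.size + C)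
    (h : PolyBdd s fun k => (a k).size) : PolyTime s a fun k => o.apply (a k) := by
  refine of_bdd (prog := .prim o) (((PolyBdd.const (1 + C)).add ((PolyBdd.const 3).mul h)))
    fun k => ⟨_, ?_, .prim o _⟩
  have := ho (a k)
  omega

theorem refl (h : PolyBdd s fun k => (a k).size) : PolyTime s a a :=
  prim_apply .ident 0 (fun x => by simp only [PrimOp.apply]; omega) h

theorem left (h : PolyTime s a b) : PolyTime s a fun k => (b k).left :=
  h.trans (prim_apply .left 1 (fun x => by
    have := x.size_left_add_size_right; simp only [PrimOp.apply]; omega) h.bdd_right)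

theorem right (h : PolyTime s a b) : PolyTime s a fun k => (b k).right :=
  h.trans (prim_apply .right 1 (fun x => by
    have := x.size_left_add_size_right; simp only [PrimOp.apply]; omega) h.bdd_right)

theorem isPair (h : PolyTime s a b) : PolyTime s a fun k => (b k).isPair :=
  h.trans (prim_apply .isPair 2 (fun x => by
    cases x <;> simp [PrimOp.apply, BData.isPair, BData.size]) h.bdd_right)

theorem constInt (z : ℤ) (h : PolyBdd s fun k => (a k).size) : PolyTime s a fun _ => .int z :=
  prim_apply (.const z) (BData.int z).size (fun x => by simp only [PrimOp.apply]; omega) h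

theorem constData (x : BData) (h : PolyBdd s fun k => (a k).size) : PolyTime s a fun _ => x := by
  induction x with
  | int z => exact constInt z h
  | pair x y hx hy => exact hx.pair hy

theorem add {y z : κ → ℤ} (hy : PolyTime s a fun k => .int (y k))
    (hz : PolyTime s a fun k => .int (z k)) : PolyTime s a fun k => .int (y k + z k) := by
  have h := hy.pair hz
  refine h.trans (prim_apply .add 2 (fun x => ?_) h.bdd_right)
  have h0 := x.size_left_add_size_right
  have h1 := x.left.size_toInt
  have h2 := x.right.size_toInt
  have h3 := Nat.size_le_size (Int.natAbs_add_le x.left.toInt x.right.toInt)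
  have h4 := Nat.size_add_le x.left.toInt.natAbs x.right.toInt.natAbs
  simp only [PrimOp.apply, BData.size]
  omega

theorem sub {y z : κ → ℤ} (hy : PolyTime s a fun k => .int (y k))
    (hz : PolyTime s a fun k => .int (z k)) : PolyTime s a fun k => .int (y k - z k) := by
  have h := hy.pair hz
  refine h.trans (prim_apply .sub 2 (fun x => ?_) h.bdd_right)
  have h0 := x.size_left_add_size_right
  have h1 := x.left.size_toInt
  have h2 := x.right.size_toInt
  have h3 := Nat.size_le_size (Int.natAbs_sub_le x.left.toInt x.right.toInt)
  have h4 := Nat.size_add_le x.left.toInt.natAbs x.right.toInt.natAbs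
  simp only [PrimOp.apply, BData.size]
  omega

theorem mul {y z : κ → ℤ} (hy : PolyTime s a fun k => .int (y k))
    (hz : PolyTime s a fun k => .int (z k)) : PolyTime s a fun k => .int (y k * z k) := by
  have h := hy.pair hz
  refine h.trans (prim_apply .mul 2 (fun x => ?_) h.bdd_right)
  have h0 := x.size_left_add_size_right
  have h1 := x.left.size_toInt
  have h2 := x.right.size_toInt
  have h4 := Nat.size_mul_le x.left.toInt.natAbs x.right.toInt.natAbs
  simp only [PrimOp.apply, BData.size, Int.natAbs_mul]
  omega

theorem le {y z : κ → ℤ} (hy : PolyTime s a fun k => .int (y k))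
    (hz : PolyTime s a fun k => .int (z k)) : PolyTime s a fun k => .bit (y k ≤ z k) := by
  have h := hy.pair hz
  refine h.trans (prim_apply .le 2 (fun x => ?_) h.bdd_right)
  simp only [PrimOp.apply]
  split_ifs <;> simp [BData.size]

theorem sum {ι : Type*} {y : κ → ι → ℤ} (S : Finset ι) (ha : PolyBdd s fun k => (a k).size)
    (h : ∀ i, PolyTime s a fun k => .int (y k i)) :
    PolyTime s a fun k => .int (∑ i ∈ S, y k i) := by
  classical
  induction S using Finset.induction_on with
  | empty => simpa using constInt 0 ha
  | insert i S hi ih => simpa [Finset.sum_insert hi] using (h i).add ih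

theorem prod {ι : Type*} {y : κ → ι → ℤ} (S : Finset ι) (ha : PolyBdd s fun k => (a k).size)
    (h : ∀ i, PolyTime s a fun k => .int (y k i)) :
    PolyTime s a fun k => .int (∏ i ∈ S, y k i) := by
  classical
  induction S using Finset.induction_on with
  | empty => simpa using constInt 1 ha
  | insert i S hi ih => simpa [Finset.prod_insert hi] using (h i).mul ih

/-- Laplace expansion has factorially many terms, but `n` is constant over the family, so the
expansion is unrolled into a program of fixed length. -/
theorem det {n : ℕ} {M : κ → Matrix (Fin n) (Fin n) ℤ} (ha : PolyBdd s fun k => (a k).size)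
    (h : ∀ i j, PolyTime s a fun k => .int (M k i j)) :
    PolyTime s a fun k => .int (M k).det := by
  induction n with
  | zero => simpa using constInt 1 ha
  | succ n ih =>
    simp only [Matrix.det_succ_row_zero]
    exact sum _ ha fun j => ((constInt _ ha).mul (h 0 j)).mul (ih fun i i' => h _ _)

/-- Each branch has to be correct only on the indices that enter it. This makes the outcome of a
test available as a hypothesis on the subtype. -/
theorem cond {t : κ → Prop} [DecidablePred t] (ht : PolyTime s a fun k => .bit (t k))
    (h₁ : PolyTime (fun k : {k // t k} => s k) (fun k => a k) fun k => b k)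
    (h₂ : PolyTime (fun k : {k // ¬ t k} => s k) (fun k => a k) fun k => b k) :
    PolyTime s a b := by
  have ha := ht.bdd_left
  obtain ⟨B, r, hr⟩ := ht
  obtain ⟨P, p, hp⟩ := h₁
  obtain ⟨Q, q, hq⟩ := h₂
  refine of_bdd (prog := .cond B P Q) (((((PolyBdd.const 1).add ha).add (PolyBdd.self.eval r)).add
    (PolyBdd.self.eval p)).add (PolyBdd.self.eval q)) fun k => ?_
  obtain ⟨u, hu, hur⟩ := hr k
  by_cases hk : t k
  · obtain ⟨v, hv, hvr⟩ := hp ⟨k, hk⟩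
    exact ⟨_, by dsimp only at hv; omega, .condTrue hur (by simp [BData.bit, BData.toInt, hk]) hvr⟩
  · obtain ⟨v, hv, hvr⟩ := hq ⟨k, hk⟩
    exact ⟨_, by dsimp only at hv; omega, .condFalse hur (by simp [BData.bit, BData.toInt, hk]) hvr⟩

/-- The states are prescribed in advance, and test and body are polynomial in `s k` uniformly in the
iteration index, so the costs of the iterations simply add up. The test is also needed at index `N
k`, where it stops the loop. -/
theorem loop {st : κ → ℕ → BData} {N : κ → ℕ} (hN : PolyBdd s N)
    (htest : PolyTime (fun p : {p : κ × ℕ // p.2 ≤ N p.1} => s p.1.1)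
      (fun p => st p.1.1 p.1.2) fun p => .bit (p.1.2 < N p.1.1))
    (hbody : PolyTime (fun p : {p : κ × ℕ // p.2 < N p.1} => s p.1.1)
      (fun p => st p.1.1 p.1.2) fun p => st p.1.1 (p.1.2 + 1)) :
    PolyTime s (fun k => st k 0) fun k => st k (N k) := by
  obtain ⟨B, r, hr⟩ := htest
  obtain ⟨P, p, hp⟩ := hbody
  refine of_bdd (prog := .loop B P) ((hN.add (PolyBdd.const 1)).mul (((PolyBdd.const 1).add
    ((PolyBdd.const 2).mul (PolyBdd.self.eval r))).add (PolyBdd.self.eval p))) fun k => ?_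
  -- Here `j` counts the remaining iterations. The term `2 * r` pays for the test and for copying
  -- the state, whose size is at most the time of the test.
  suffices h : ∀ j i, i + j = N k → (Prog.loop B P).RunsWithin (st k i) (st k (N k))
      ((j + 1) * (1 + 2 * r.eval (s k) + p.eval (s k))) from h (N k) 0 (zero_add _)
  intro j
  induction j with
  | zero =>
    intro i hi
    obtain rfl : i = N k := hi
    obtain ⟨u, hu, hur⟩ := hr ⟨(k, N k), le_rfl⟩
    have := hur.size_le.1
    exact ⟨_, by dsimp only at hu this; omega, .loopDone hur (by simp [BData.bit, BData.toInt])⟩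
  | succ j ih =>
    intro i hi
    have hlt : i < N k := by omega
    obtain ⟨u, hu, hur⟩ := hr ⟨(k, i), hlt.le⟩
    obtain ⟨v, hv, hvr⟩ := hp ⟨(k, i), hlt⟩
    obtain ⟨w, hw, hwr⟩ := ih (i + 1) (by omega)
    have := hur.size_le.1
    refine ⟨_, ?_, .loopStep hur (by simp [BData.bit, BData.toInt, hlt]) hvr hwr⟩
    rw [add_mul (j + 1)]
    dsimp only at hu hv this
    omega

/-! ### Lists -/

/-- The empty list is the leaf `0`, which `left` and `right` map to the leaf `0`; running past the
end therefore yields the default value. -/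
theorem getD_ofList {l : κ → List BData} (h : PolyTime s a fun k => .ofList (l k)) (i : ℕ) :
    PolyTime s a fun k => (l k).getD i (.int 0) := by
  induction i generalizing l with
  | zero =>
    convert h.left using 2 with k
    cases l k <;> simp [BData.ofList, BData.left]
  | succ i ih =>
    have : PolyTime s a fun k => .ofList (l k).tail := by
      convert h.right using 2 with k
      cases l k <;> simp [BData.ofList, BData.right]
    convert ih this using 2 with k
    cases l k <;> simp

theorem ofFn {n : ℕ} {v : κ → Fin n → BData} (ha : PolyBdd s fun k => (a k).size)
    (h : ∀ i, PolyTime s a fun k => v k i) : PolyTime s a fun k => .ofList (List.ofFn (v k)) := by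
  induction n with
  | zero => simpa [BData.ofList] using constInt 0 ha
  | succ n ih =>
    simp only [List.ofFn_succ, BData.ofList]
    exact (h 0).pair (ih fun i => h _)

theorem of_ofFn {n : ℕ} {v : κ → Fin n → BData} (h : PolyTime s a fun k => .ofList (List.ofFn (v k)))
    (i : Fin n) : PolyTime s a fun k => v k i := by
  simpa using h.getD_ofList i

theorem isPair_ofList {l : κ → List BData} (h : PolyTime s a fun k => .ofList (l k)) :
    PolyTime s a fun k => .bit (l k ≠ []) := by
  convert h.isPair using 2 with k
  cases l k <;> simp [BData.ofList, BData.isPair, BData.bit]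

theorem isSome_ofOption {v : κ → Option BData} (h : PolyTime s a fun k => .ofOption (v k)) :
    PolyTime s a fun k => .bit (v k ≠ none) := by
  convert h.isPair using 2 with k
  cases v k <;> simp [BData.ofOption, BData.isPair, BData.bit]

/-- A loop over the whole list whose state consists of the first hit so far, the remaining list and
the context `a`. The context is kept because `φ` may depend on it. -/
theorem findSome {β : Type*} {e : β → BData} {l : κ → List β} {φ : κ → β → Option BData}
    (hl : PolyTime s a fun k => .ofList ((l k).map e))
    (hφ : PolyTime (fun p : {p : κ × β // p.2 ∈ l p.1} => s p.1.1)
      (fun p => .pair (e p.1.2) (a p.1.1)) fun p => .ofOption (φ p.1.1 p.1.2)) :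
    PolyTime s a fun k => .ofOption ((l k).findSome? (φ k)) := by
  have ha := hl.bdd_left
  have hlb := hl.bdd_right
  have hlen : PolyBdd s fun k => (l k).length := hlb.mono fun k => by
    simpa using BData.length_le_size_ofList ((l k).map e)
  -- The accumulator is empty or a single value of `φ`, so it does not grow with the number of
  -- iterations.
  have hacc : PolyBdd (fun p : κ × ℕ => s p.1) fun p =>
      BData.size (.ofOption (((l p.1).take p.2).findSome? (φ p.1))) := by
    obtain ⟨q, hq⟩ := hφ.bdd_right
    refine ⟨q + 1, fun p => ?_⟩
    rcases h : ((l p.1).take p.2).findSome? (φ p.1) with _ | y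
    · simp [h, BData.ofOption, BData.size]
    · obtain ⟨x, hx, hxy⟩ := List.exists_of_findSome?_eq_some h
      have := hq ⟨(p.1, x), List.mem_of_mem_take hx⟩
      simp only [hxy] at this
      simpa [h] using this.trans (Nat.le_succ _)
  set st : κ → ℕ → BData := fun k i => .pair (.ofOption (((l k).take i).findSome? (φ k)))
    (.pair (.ofList (((l k).drop i).map e)) (a k)) with hst
  have hstb : PolyBdd (fun p : κ × ℕ => s p.1) fun p => (st p.1 p.2).size := by
    refine ((hacc.add ((hlb.reindex Prod.fst).add (ha.reindex Prod.fst))).add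
      (PolyBdd.const 2)).mono fun p => ?_
    have := BData.size_ofList_drop_le ((l p.1).map e) p.2
    simp only [hst, BData.size_pair, List.map_drop]
    omega
  have hinit : PolyTime s a fun k => st k 0 := by
    simpa [hst, BData.ofOption] using (constInt 0 ha).pair (hl.pair (refl ha))
  have hloop := loop (st := st) (N := fun k => (l k).length) hlen ?_ ?_
  · simpa [hst] using (hinit.trans hloop).left
  · have h := refl (hstb.reindex fun p : {p : κ × ℕ // p.2 ≤ (l p.1).length} => p.1)
    convert h.right.left.isPair_ofList using 2 with p
    simp [BData.bit, List.drop_eq_nil_iff]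
  · have h := refl (hstb.reindex fun p : {p : κ × ℕ // p.2 < (l p.1).length} => p.1)
    have hrest : PolyTime (fun p : {p : κ × ℕ // p.2 < (l p.1).length} => s p.1.1)
        (fun p => st p.1.1 p.1.2) fun p => .ofList (((l p.1.1).drop (p.1.2 + 1)).map e) := by
      convert h.right.left.right using 2 with p
      simp only [hst, BData.left_pair, BData.right_pair]
      rw [List.drop_eq_getElem_cons p.2]
      rfl
    have hx : PolyTime (fun p : {p : κ × ℕ // p.2 < (l p.1).length} => s p.1.1)
        (fun p => st p.1.1 p.1.2) fun p => e ((l p.1.1)[p.1.2]'p.2) := by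
      convert h.right.left.left using 2 with p
      simp only [hst, BData.left_pair, BData.right_pair]
      rw [List.drop_eq_getElem_cons p.2]
      rfl
    have hnew : PolyTime (fun p : {p : κ × ℕ // p.2 < (l p.1).length} => s p.1.1)
        (fun p => st p.1.1 p.1.2) fun p => .ofOption (φ p.1.1 ((l p.1.1)[p.1.2]'p.2)) :=
      (hx.pair h.right.right).trans (hφ.reindex fun p : {p : κ × ℕ // p.2 < (l p.1).length} =>
        ⟨(p.1.1, (l p.1.1)[p.1.2]'p.2), List.getElem_mem _⟩)
    refine PolyTime.pair ?_ (hrest.pair h.right.right)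
    -- An earlier hit takes precedence over later ones, so the loop needs no early exit.
    have hstep : ∀ p : {p : κ × ℕ // p.2 < (l p.1).length},
        ((l p.1.1).take (p.1.2 + 1)).findSome? (φ p.1.1) =
          (((l p.1.1).take p.1.2).findSome? (φ p.1.1)).or (φ p.1.1 ((l p.1.1)[p.1.2]'p.2)) := by
      intro p
      rw [← List.take_concat_get' _ _ p.2, List.findSome?_append]
      simp
    simp only [hstep]
    refine cond (isSome_ofOption h.left) ?_ ?_
    · convert h.left.reindex Subtype.val using 2 with p
      obtain ⟨y, hy⟩ := Option.ne_none_iff_exists'.1 p.2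
      simp [hst, hy]
    · convert hnew.reindex Subtype.val using 2 with p
      simp [not_not.1 p.2]

end PolyTime

/-! ## Facets of the upper hull of finitely many points -/

/-- The generalized cross product of `d` vectors in dimension `d + 1`. -/
def crossVec {A : Type*} [CommRing A] {d : ℕ} (T : Fin d → Fin (d + 1) → A) : Fin (d + 1) → A :=
  fun j => (-1) ^ (j : ℕ) * ((Matrix.of T).submatrix id j.succAbove).det

/-- Cofactor expansion of the determinant along its first row `v`. -/
theorem crossVec_dotProduct {A : Type*} [CommRing A] {d : ℕ} (T : Fin d → Fin (d + 1) → A)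
    (v : Fin (d + 1) → A) : crossVec T ⬝ᵥ v = (Matrix.of (Matrix.vecCons v T)).det := by
  rw [Matrix.det_succ_row_zero]
  refine Finset.sum_congr rfl fun j _ => ?_
  have : (Matrix.of (Matrix.vecCons v T)).submatrix Fin.succ j.succAbove =
      (Matrix.of T).submatrix id j.succAbove := by
    ext i k; simp
  rw [this]
  simp only [crossVec, Matrix.of_apply, Matrix.cons_val_zero]
  ring

theorem crossVec_dotProduct_self {A : Type*} [CommRing A] {d : ℕ} (T : Fin d → Fin (d + 1) → A)
    (i : Fin d) : crossVec T ⬝ᵥ T i = 0 := by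
  rw [crossVec_dotProduct]
  exact Matrix.det_zero_of_row_eq (Fin.succ_ne_zero i).symm (by ext; simp)

/-- The vector of reals given by a vector of integers. -/
def toReal {n : ℕ} (g : Fin n → ℤ) : Fin n → ℝ := fun k => (g k : ℝ)

theorem toReal_crossVec {d : ℕ} (T : Fin d → Fin (d + 1) → ℤ) :
    toReal (crossVec T) = crossVec fun i => toReal (T i) := by
  ext j
  simp only [toReal, crossVec, Int.cast_mul, Int.cast_pow, Int.cast_neg, Int.cast_one,
    Int.cast_det]
  rfl

theorem toReal_dotProduct {n : ℕ} (g h : Fin n → ℤ) : toReal g ⬝ᵥ toReal h = ((g ⬝ᵥ h : ℤ) : ℝ) := by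
  simp [toReal, dotProduct]

theorem toReal_smul {n : ℕ} (z : ℤ) (g : Fin n → ℤ) : toReal (z • g) = (z : ℝ) • toReal g := by
  ext; simp [toReal]

section

variable {d : ℕ}

/-- The halfspace `{z | 0 ≤ hᵀ (1, z)}`. -/
def homHalfspace (h : Fin (d + 1) → ℝ) : Set (Fin d → ℝ) := halfspace (Matrix.vecTail h) (-h 0)

theorem dotProduct_vecCons (h : Fin (d + 1) → ℝ) (t : ℝ) (z : Fin d → ℝ) :
    h ⬝ᵥ Matrix.vecCons t z = h 0 * t + Matrix.vecTail h ⬝ᵥ z := by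
  rw [Matrix.dotProduct_cons]; rfl

theorem mem_homHalfspace {h : Fin (d + 1) → ℝ} {z : Fin d → ℝ} :
    z ∈ homHalfspace h ↔ 0 ≤ h ⬝ᵥ Matrix.vecCons 1 z := by
  rw [dotProduct_vecCons, homHalfspace, halfspace, Set.mem_ofPred_eq]
  constructor <;> intro <;> linarith

theorem homHalfspace_smul {μ : ℝ} (hμ : 0 < μ) (h : Fin (d + 1) → ℝ) :
    homHalfspace (μ • h) = homHalfspace h := by
  ext z
  simp [mem_homHalfspace, smul_dotProduct, mul_nonneg_iff_of_pos_left hμ]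

theorem halfspace_eq_homHalfspace (w : Fin d → ℝ) (c : ℝ) :
    halfspace w c = homHalfspace (Matrix.vecCons (-c) w) := by
  simp [homHalfspace]

/-- The convex hull of `Y` plus the nonnegative orthant. -/
def upperHull (Y : Set (Fin d → ℝ)) : Set (Fin d → ℝ) := convexHull ℝ Y + {z | 0 ≤ z}

/-- The homogeneous coordinates of the `i`-th unit direction. -/
def unitDir (i : Fin d) : Fin (d + 1) → ℤ := Matrix.vecCons 0 (Pi.single i 1)

/-- The integer vector `g` gives homogeneous coordinates of the point `y`. -/
def Represents (g : Fin (d + 1) → ℤ) (y : Fin d → ℝ) : Prop :=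
  0 < g 0 ∧ toReal g = (g 0 : ℝ) • Matrix.vecCons 1 y

/-- `G` consists of homogeneous coordinates of the points of `Y` and of the unit directions. -/
structure IsGens (Y : Set (Fin d → ℝ)) (G : Set (Fin (d + 1) → ℤ)) : Prop where
  cases : ∀ g ∈ G, (∃ y ∈ Y, Represents g y) ∨ ∃ i, g = unitDir i
  point : ∀ y ∈ Y, ∃ g ∈ G, Represents g y
  dir : ∀ i, unitDir i ∈ G

/-- The elements of `G` on which `h` vanishes. -/
def vanishing (G : Set (Fin (d + 1) → ℤ)) (h : Fin (d + 1) → ℝ) : Set (Fin (d + 1) → ℝ) :=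
  toReal '' {g ∈ G | h ⬝ᵥ toReal g = 0}

theorem toReal_unitDir (i : Fin d) :
    toReal (unitDir i) = Matrix.vecCons (0 : ℝ) (Pi.single i 1) := by
  ext j
  refine Fin.cases ?_ (fun j => ?_) j
  · simp [toReal, unitDir]
  · by_cases hj : j = i <;> simp [toReal, unitDir, hj]

theorem dotProduct_unitDir (h : Fin (d + 1) → ℝ) (i : Fin d) :
    h ⬝ᵥ toReal (unitDir i) = h i.succ := by
  rw [toReal_unitDir, dotProduct_vecCons]
  simp [Matrix.vecTail]

theorem finrank_span_singleton_le_one {n : ℕ} (v : Fin n → ℝ) :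
    Module.finrank ℝ (Submodule.span ℝ {v}) ≤ 1 := by
  simpa using finrank_span_le_card (R := ℝ) ({v} : Set (Fin n → ℝ))

theorem dotProduct_eq_zero_of_mem_span {n : ℕ} {h v : Fin n → ℝ} {V : Set (Fin n → ℝ)}
    (hV : ∀ u ∈ V, h ⬝ᵥ u = 0) (hv : v ∈ Submodule.span ℝ V) : h ⬝ᵥ v = 0 := by
  induction hv using Submodule.span_induction with
  | mem u hu => exact hV u hu
  | zero => simp
  | add x y _ _ hx hy => simp [dotProduct_add, hx, hy]
  | smul t x _ hx => simp [dotProduct_smul, hx]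

variable {Y : Set (Fin d → ℝ)} {G : Set (Fin (d + 1) → ℤ)} {h : Fin (d + 1) → ℝ}

theorem vanishing_dotProduct {v : Fin (d + 1) → ℝ} (hv : v ∈ vanishing G h) : h ⬝ᵥ v = 0 := by
  obtain ⟨g, hg, rfl⟩ := hv
  exact hg.2

theorem Represents.vecCons_eq {g : Fin (d + 1) → ℤ} {y : Fin d → ℝ} (hg : Represents g y) :
    Matrix.vecCons 1 y = (g 0 : ℝ)⁻¹ • toReal g := by
  have : (g 0 : ℝ) ≠ 0 := by exact_mod_cast hg.1.ne'
  rw [hg.2, smul_smul, inv_mul_cancel₀ this, one_smul]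

theorem Represents.pos {g : Fin (d + 1) → ℤ} {y : Fin d → ℝ} (hg : Represents g y) :
    (0 : ℝ) < g 0 := by exact_mod_cast hg.1

/-- On homogeneous coordinates of points of the upper hull, `h` is nonnegative, and where it
vanishes they are spanned by the generators on which it vanishes. -/
theorem IsGens.mem_upperHull (hG : IsGens Y G) (hh : ∀ g ∈ G, 0 ≤ h ⬝ᵥ toReal g) {z : Fin d → ℝ}
    (hz : z ∈ upperHull Y) : 0 ≤ h ⬝ᵥ Matrix.vecCons 1 z ∧ (h ⬝ᵥ Matrix.vecCons 1 z = 0 →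
      Matrix.vecCons 1 z ∈ Submodule.span ℝ (vanishing G h)) := by
  -- `C` is closed under sums and nonnegative multiples and contains all generators, hence also the
  -- homogeneous coordinates of every point of the upper hull.
  set C : Set (Fin (d + 1) → ℝ) :=
    {v | 0 ≤ h ⬝ᵥ v ∧ (h ⬝ᵥ v = 0 → v ∈ Submodule.span ℝ (vanishing G h))} with hC
  have hadd : ∀ u v, u ∈ C → v ∈ C → u + v ∈ C := by
    rintro u v ⟨hu, hu'⟩ ⟨hv, hv'⟩
    refine ⟨by rw [dotProduct_add]; positivity, fun h0 => ?_⟩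
    rw [dotProduct_add] at h0
    exact add_mem (hu' (by linarith)) (hv' (by linarith))
  have hsmul : ∀ (t : ℝ) u, 0 ≤ t → u ∈ C → t • u ∈ C := by
    rintro t u ht ⟨hu, hu'⟩
    refine ⟨by rw [dotProduct_smul, smul_eq_mul]; positivity, fun h0 => ?_⟩
    rw [dotProduct_smul, smul_eq_mul, mul_eq_zero] at h0
    rcases h0 with rfl | h0
    · simp
    · exact Submodule.smul_mem _ _ (hu' h0)
  have hgen : ∀ g ∈ G, toReal g ∈ C := fun g hg =>
    ⟨hh g hg, fun h0 => Submodule.subset_span ⟨g, ⟨hg, h0⟩, rfl⟩⟩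
  obtain ⟨v, hv, u, hu, rfl⟩ := hz
  have h1 : Matrix.vecCons 1 v ∈ C := by
    refine convexHull_min (t := {v | Matrix.vecCons 1 v ∈ C}) (fun y hy => ?_) ?_ hv
    · obtain ⟨g, hg, hgy⟩ := hG.point y hy
      rw [Set.mem_ofPred_eq, hgy.vecCons_eq]
      exact hsmul _ _ (by have := hgy.pos; positivity) (hgen g hg)
    · intro x hx y hy α β hα hβ hαβ
      have : (Matrix.vecCons 1 (α • x + β • y) : Fin (d + 1) → ℝ) =
          α • Matrix.vecCons 1 x + β • Matrix.vecCons 1 y := by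
        simp [Matrix.smul_cons, hαβ]
      rw [Set.mem_ofPred_eq, this]
      exact hadd _ _ (hsmul _ _ hα hx) (hsmul _ _ hβ hy)
  have h2 : (Matrix.vecCons 0 u : Fin (d + 1) → ℝ) ∈ C := by
    have : (Matrix.vecCons 0 u : Fin (d + 1) → ℝ) = ∑ i, u i • toReal (unitDir i) := by
      ext j
      refine Fin.cases ?_ (fun j => ?_) j
      · simp [toReal_unitDir]
      · simp [toReal_unitDir, Finset.sum_apply, Pi.single_apply]
    rw [this]
    have hzero : (0 : Fin (d + 1) → ℝ) ∈ C := ⟨by simp, fun _ => zero_mem _⟩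
    exact Finset.sum_induction _ (· ∈ C) hadd hzero fun i _ => hsmul _ _ (hu i) (hgen _ (hG.dir i))
  have := hadd _ _ h1 h2
  rwa [Matrix.cons_add_cons, add_zero] at this

theorem IsGens.upperHull_subset (hG : IsGens Y G) (hh : ∀ g ∈ G, 0 ≤ h ⬝ᵥ toReal g) :
    upperHull Y ⊆ homHalfspace h := fun _ hz => mem_homHalfspace.2 (hG.mem_upperHull hh hz).1

theorem add_mem_upperHull {z u : Fin d → ℝ} (hz : z ∈ upperHull Y) (hu : 0 ≤ u) :
    z + u ∈ upperHull Y := by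
  obtain ⟨v, hv, u', hu', rfl⟩ := hz
  exact ⟨v, hv, u' + u, add_nonneg (a := u') hu' hu, by simp [add_assoc]⟩

theorem subset_upperHull {y : Fin d → ℝ} (hy : y ∈ Y) : y ∈ upperHull Y :=
  ⟨y, subset_convexHull ℝ Y hy, 0, le_refl (0 : Fin d → ℝ), by simp⟩

theorem nonneg_of_upperHull_subset (hY : Y.Nonempty) {w : Fin d → ℝ} {c : ℝ}
    (hw : upperHull Y ⊆ halfspace w c) : 0 ≤ w := by
  obtain ⟨y, hy⟩ := hY
  intro i
  by_contra! hi
  rw [Pi.zero_apply] at hi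
  -- With this `t`, the point `y + t e_i` of the upper hull has value `c - 1`, which violates the
  -- halfspace.
  set t : ℝ := (w ⬝ᵥ y - c + 1) / (-w i) with ht
  have hc : c ≤ w ⬝ᵥ y := hw (subset_upperHull hy)
  have ht0 : 0 ≤ t := div_nonneg (by linarith) (by linarith)
  have h2 := hw (add_mem_upperHull (subset_upperHull hy) (u := Pi.single i t)
    (by simpa using ht0))
  have h3 : c ≤ w ⬝ᵥ y + w i * t := by simpa [halfspace, dotProduct_add] using h2
  have h4 : w i * t = -(w ⬝ᵥ y - c + 1) := by
    rw [ht, mul_div_assoc', div_neg, mul_div_cancel_left₀ _ hi.ne]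
  linarith

theorem IsGens.nonneg_of_subset (hG : IsGens Y G) (hY : Y.Nonempty)
    (hh : upperHull Y ⊆ homHalfspace h) : ∀ g ∈ G, 0 ≤ h ⬝ᵥ toReal g := by
  intro g hg
  rcases hG.cases g hg with ⟨y, hy, hgy⟩ | ⟨i, rfl⟩
  · rw [hgy.2, dotProduct_smul, smul_eq_mul]
    exact mul_nonneg hgy.pos.le (mem_homHalfspace.1 (hh (subset_upperHull hy)))
  · rw [dotProduct_unitDir]
    exact nonneg_of_upperHull_subset hY hh i

/-- If `h ≠ 0` vanishes on a `d`-dimensional set of generators, then it is a multiple of the cross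
product of `d` generators. -/
theorem exists_crossVec (h0 : h ≠ 0)
    (hr : d ≤ Module.finrank ℝ (Submodule.span ℝ (vanishing G h))) :
    ∃ T : Fin d → Fin (d + 1) → ℤ, (∀ i, T i ∈ G) ∧ ∃ σ : ℤ, (σ = 1 ∨ σ = -1) ∧
      ∃ μ : ℝ, 0 < μ ∧ toReal (σ • crossVec T) = μ • h := by
  obtain ⟨f, hf, -, hli⟩ := Submodule.exists_fun_fin_finrank_span_eq ℝ (vanishing G h)
  have hf' : ∀ i : Fin d, ∃ g ∈ G, toReal g = f (Fin.castLE hr i) ∧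
      h ⬝ᵥ toReal g = 0 := by
    intro i
    obtain ⟨g, hg, hgf⟩ := hf (Fin.castLE hr i)
    exact ⟨g, hg.1, hgf, hg.2⟩
  choose T hTG hTf hT0 using hf'
  have hT : LinearIndependent ℝ fun i => toReal (T i) := by
    simp only [hTf]
    exact hli.comp _ (Fin.castLE_injective hr)
  have hhh : 0 < h ⬝ᵥ h := by
    have := dotProduct_self_star_nonneg h
    simp only [star_trivial] at this
    exact lt_of_le_of_ne this fun h' => h0 (dotProduct_self_eq_zero.1 h'.symm)
  -- `h` is orthogonal to all `T i` but not to itself, so it lies outside their span.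
  have hli' : LinearIndependent ℝ (Matrix.vecCons h fun i => toReal (T i)) := by
    refine linearIndependent_finCons.2 ⟨hT, fun hs => hhh.ne' ?_⟩
    exact dotProduct_eq_zero_of_mem_span (by rintro _ ⟨i, rfl⟩; exact hT0 i) hs
  set c : Fin (d + 1) → ℝ := crossVec fun i => toReal (T i) with hc
  have hcT : ∀ i, c ⬝ᵥ toReal (T i) = 0 := fun i => crossVec_dotProduct_self (fun i => toReal (T i)) i
  have hch : c ⬝ᵥ h ≠ 0 := by
    rw [hc, crossVec_dotProduct]
    intro hdet
    obtain ⟨v, hv, hv0⟩ := Matrix.exists_vecMul_eq_zero_iff.2 hdet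
    refine hv (funext fun i => Fintype.linearIndependent_iff.1 hli' v ?_ i)
    rw [← hv0]
    ext j
    simp [Matrix.vecMul, dotProduct, Finset.sum_apply]
  have hspan : Submodule.span ℝ (Set.range (Matrix.vecCons h fun i => toReal (T i))) = ⊤ :=
    hli'.span_eq_top_of_card_eq_finrank (by simp)
  -- This combination is orthogonal to `h` and to every `T i`; these vectors form a basis, so it
  -- vanishes and `c` is parallel to `h`.
  have hu : (h ⬝ᵥ h) • c - (c ⬝ᵥ h) • h = 0 := by
    rw [← dotProduct_self_eq_zero]
    refine dotProduct_eq_zero_of_mem_span (V := Set.range (Matrix.vecCons h fun i => toReal (T i)))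
      ?_ (hspan ▸ Submodule.mem_top)
    rintro _ ⟨i, rfl⟩
    refine Fin.cases ?_ (fun i => ?_) i
    · simp [sub_dotProduct, smul_dotProduct, mul_comm]
    · simp [sub_dotProduct, smul_dotProduct, hcT, hT0]
  have hc' : c = ((c ⬝ᵥ h) / (h ⬝ᵥ h)) • h := by
    have := congrArg ((h ⬝ᵥ h)⁻¹ • ·) (sub_eq_zero.1 hu)
    simpa only [smul_smul, inv_mul_cancel₀ hhh.ne', one_smul, ← div_eq_inv_mul] using this
  refine ⟨T, hTG, ?_⟩
  rcases lt_or_gt_of_ne hch with hneg | hpos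
  · refine ⟨-1, Or.inr rfl, -((c ⬝ᵥ h) / (h ⬝ᵥ h)), ?_, ?_⟩
    · rw [← neg_div]; exact div_pos (by linarith) hhh
    · rw [toReal_smul, toReal_crossVec, ← hc, neg_smul, ← hc']; simp
  · refine ⟨1, Or.inl rfl, (c ⬝ᵥ h) / (h ⬝ᵥ h), div_pos hpos hhh, ?_⟩
    rw [toReal_smul, toReal_crossVec, ← hc, ← hc']; simp

theorem vectorSpan_upperHull (hY : Y.Nonempty) : vectorSpan ℝ (upperHull Y) = ⊤ := by
  obtain ⟨y, hy⟩ := hY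
  rw [eq_top_iff]
  intro v _
  have : v = ∑ i, v i • (Pi.single i 1 : Fin d → ℝ) := by
    ext j; simp [Finset.sum_apply, Pi.single_apply]
  rw [this]
  refine Submodule.sum_mem _ fun i _ => Submodule.smul_mem _ _ ?_
  have := vsub_mem_vectorSpan ℝ (add_mem_upperHull (subset_upperHull hy)
    (u := Pi.single i 1) (by simp)) (subset_upperHull hy)
  simpa using this

/-- The linear map `v ↦ (0, v)`. -/
def consZero (d : ℕ) : (Fin d → ℝ) →ₗ[ℝ] Fin (d + 1) → ℝ where
  toFun v := Matrix.vecCons 0 v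
  map_add' u v := by simp
  map_smul' t v := by simp [Matrix.smul_cons]

theorem consZero_apply (v : Fin d → ℝ) : consZero d v = Matrix.vecCons 0 v := rfl

theorem consZero_injective : Function.Injective (consZero d) := fun u v huv => by
  funext i
  simpa [consZero_apply] using congrFun huv i.succ

theorem finrank_map_consZero (V : Submodule ℝ (Fin d → ℝ)) :
    Module.finrank ℝ (V.map (consZero d)) = Module.finrank ℝ V :=
  (Submodule.equivMapOfInjective _ consZero_injective V).finrank_eq.symm

theorem vecCons_one_notMem (V : Submodule ℝ (Fin d → ℝ)) (y : Fin d → ℝ) :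
    Matrix.vecCons 1 y ∉ V.map (consZero d) := by
  rintro ⟨v, -, hv⟩
  simpa [consZero_apply] using congrFun hv 0

/-- The halfspaces whose boundary is spanned by `d` elements of `G`. -/
def candidates (G : Set (Fin (d + 1) → ℤ)) : Set (Set (Fin d → ℝ)) :=
  {H | ∃ T : Fin d → Fin (d + 1) → ℤ, (∀ i, T i ∈ G) ∧ ∃ σ : ℤ, (σ = 1 ∨ σ = -1) ∧
    H = homHalfspace (toReal (σ • crossVec T))}

/-- A facet has affine dimension `d - 1`, so its points span a `d`-dimensional space in homogeneous
coordinates. That space is contained in the span of the generators on the boundary, and `d`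
independent ones among them determine the normal up to scaling. -/
theorem IsGens.facetHalfspaces_subset (hG : IsGens Y G) (hY : Y.Nonempty) :
    facetHalfspaces (upperHull Y) ⊆ candidates G := by
  rintro _ ⟨w, c, hw, rfl, hP, F, ⟨hF, ⟨z₀, hz₀⟩, hdim⟩, hFw⟩
  set h : Fin (d + 1) → ℝ := Matrix.vecCons (-c) w with hh
  rw [halfspace_eq_homHalfspace, ← hh] at hP ⊢
  have h0 : h ≠ 0 := fun h' => hw (by
    funext i; simpa [hh] using congrFun h' i.succ)
  have hFP : F ⊆ upperHull Y := by
    rcases hF with rfl | ⟨w', c', -, -, rfl⟩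
    · exact subset_rfl
    · exact Set.inter_subset_left
  have hnn := hG.nonneg_of_subset hY hP
  have hFS : ∀ z ∈ F, Matrix.vecCons 1 z ∈ Submodule.span ℝ (vanishing G h) := by
    intro z hz
    refine (hG.mem_upperHull hnn (hFP hz)).2 ?_
    have : w ⬝ᵥ z = c := hFw hz
    rw [dotProduct_vecCons]
    simp [hh, this]
  have hr : d ≤ Module.finrank ℝ (Submodule.span ℝ (vanishing G h)) := by
    rw [vectorSpan_upperHull hY, finrank_top, Module.finrank_fintype_fun_eq_card,
      Fintype.card_fin] at hdim
    -- The directions of `F` have first coordinate `0` and the point `z₀` has first coordinate `1`;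
    -- this makes the inclusion strict and supplies the missing dimension.
    have hlt : (vectorSpan ℝ F).map (consZero d) < Submodule.span ℝ (vanishing G h) := by
      refine lt_of_le_of_ne ?_ fun heq => vecCons_one_notMem (vectorSpan ℝ F) z₀ ?_
      · rw [vectorSpan_def, Submodule.map_span, Submodule.span_le]
        rintro _ ⟨_, ⟨u, hu, v, hv, rfl⟩, rfl⟩
        have : consZero d (u -ᵥ v) = Matrix.vecCons 1 u - Matrix.vecCons 1 v := by
          simp [consZero_apply, Matrix.sub_cons]
        rw [this]
        exact sub_mem (hFS u hu) (hFS v hv)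
      · rw [heq]; exact hFS z₀ hz₀
    have := Submodule.finrank_lt_finrank_of_lt hlt
    rw [finrank_map_consZero] at this
    omega
  obtain ⟨T, hT, σ, hσ, μ, hμ, hTh⟩ := exists_crossVec h0 hr
  exact ⟨T, hT, σ, hσ, by rw [hTh, homHalfspace_smul hμ]⟩

/-- A valid halfspace that is spanned by generators and has a nonzero normal supports a facet. -/
theorem IsGens.mem_facetHalfspaces (hG : IsGens Y G) (hY : Y.Nonempty)
    {T : Fin d → Fin (d + 1) → ℤ} (hT : ∀ i, T i ∈ G) {σ : ℤ}
    (hh : h = toReal (σ • crossVec T)) (hnn : ∀ g ∈ G, 0 ≤ h ⬝ᵥ toReal g)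
    (hw : Matrix.vecTail h ≠ 0) : homHalfspace h ∈ facetHalfspaces (upperHull Y) := by
  have hP := hG.upperHull_subset hnn
  have hhT : ∀ i, h ⬝ᵥ toReal (T i) = 0 := fun i => by
    rw [hh, toReal_dotProduct, smul_dotProduct, crossVec_dotProduct_self]; simp
  have hTli : LinearIndependent ℝ fun i => toReal (T i) := by
    have hhh : h ⬝ᵥ h ≠ 0 := fun h' => hw (by
      rw [dotProduct_self_eq_zero.1 h']; rfl)
    -- Up to the factor `σ`, this determinant is `h ⬝ᵥ h`.
    have hdet : (Matrix.of (Matrix.vecCons h fun i => toReal (T i))).det ≠ 0 := by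
      rw [← crossVec_dotProduct, ← toReal_crossVec]
      intro h'
      apply hhh
      conv_lhs => arg 1; rw [hh, toReal_smul]
      rw [smul_dotProduct, h', smul_zero]
    exact (linearIndependent_finCons.1 (Matrix.linearIndependent_rows_of_det_ne_zero hdet)).1
  set F : Set (Fin d → ℝ) := upperHull Y ∩ hyperplane (Matrix.vecTail h) (-h 0) with hF
  have hmemF : ∀ y ∈ upperHull Y, h ⬝ᵥ Matrix.vecCons 1 y = 0 → y ∈ F := by
    intro y hy h0
    refine ⟨hy, ?_⟩
    rw [dotProduct_vecCons] at h0
    rw [hyperplane, Set.mem_ofPred_eq]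
    linarith
  have hrep : ∀ i y, y ∈ Y → Represents (T i) y → y ∈ F := by
    intro i y hy hiy
    exact hmemF y (subset_upperHull hy) (by rw [hiy.vecCons_eq, dotProduct_smul, hhT, smul_zero])
  -- If the boundary contained no point, the `d` independent vectors `T i` would be all the unit
  -- directions, and every weight of `h` would vanish.
  obtain ⟨y₀, hy₀⟩ : F.Nonempty := by
    by_contra hne
    have hdir : ∀ i, ∃ k, T i = unitDir k := fun i =>
      (hG.cases _ (hT i)).resolve_left fun ⟨y, hy, hiy⟩ => hne ⟨y, hrep i y hy hiy⟩
    choose π hπ using hdir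
    have hinj : Function.Injective π := fun i j hij => hTli.injective (by
      simp only [hπ, hij])
    have hsurj := Finite.surjective_of_injective hinj
    refine hw (funext fun k => ?_)
    obtain ⟨i, rfl⟩ := hsurj k
    have := hhT i
    rwa [hπ, dotProduct_unitDir] at this
  -- Relative to `y₀`, a generator that represents a point gives the direction from `y₀` to it, and
  -- a unit direction keeps `y₀` inside `F`. Hence `F` has dimension at least `d - 1`.
  have hspan : Submodule.span ℝ (Set.range fun i => toReal (T i)) ≤
      (vectorSpan ℝ F).map (consZero d) ⊔ Submodule.span ℝ {Matrix.vecCons 1 y₀} := by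
    rw [Submodule.span_le]
    rintro _ ⟨i, rfl⟩
    rcases hG.cases _ (hT i) with ⟨y, hy, hiy⟩ | ⟨k, hk⟩
    · have : Matrix.vecCons 1 y = consZero d (y -ᵥ y₀) + Matrix.vecCons 1 y₀ := by
        simp [consZero_apply]
      simp only [hiy.2, this]
      refine Submodule.smul_mem _ _ (Submodule.add_mem_sup (Submodule.mem_map_of_mem ?_)
        (Submodule.mem_span_singleton_self _))
      exact vsub_mem_vectorSpan ℝ (hrep i y hy hiy) hy₀
    · refine Submodule.mem_sup_left ⟨Pi.single k 1, ?_, by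
        simp only [hk, toReal_unitDir, consZero_apply]⟩
      have hmem : y₀ + Pi.single k 1 ∈ F := by
        refine hmemF _ (add_mem_upperHull hy₀.1 (by simp)) ?_
        have h1 := hhT i
        rw [hk, dotProduct_unitDir] at h1
        have h2 : Matrix.vecTail h ⬝ᵥ y₀ = -h 0 := hy₀.2
        have h3 : Matrix.vecTail h k = 0 := h1
        rw [dotProduct_vecCons, dotProduct_add, h2]
        simp [h3]
      simpa using vsub_mem_vectorSpan ℝ hmem hy₀
  have hlow : d ≤ Module.finrank ℝ (vectorSpan ℝ F) + 1 := by
    have h1 := Submodule.finrank_mono hspan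
    rw [finrank_span_eq_card hTli, Fintype.card_fin] at h1
    have h2 := Submodule.finrank_add_le_finrank_add_finrank
      ((vectorSpan ℝ F).map (consZero d)) (Submodule.span ℝ {Matrix.vecCons 1 y₀})
    rw [finrank_map_consZero] at h2
    exact h1.trans (h2.trans (Nat.add_le_add_left (finrank_span_singleton_le_one _) _))
  have hup : Module.finrank ℝ (vectorSpan ℝ F) < d := by
    have hlt : vectorSpan ℝ F < ⊤ := by
      refine lt_of_le_of_ne le_top fun htop => hw ?_
      rw [← dotProduct_self_eq_zero]
      refine dotProduct_eq_zero_of_mem_span (V := F -ᵥ F) ?_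
        (by rw [← vectorSpan_def, htop]; trivial)
      rintro _ ⟨u, hu, v, hv, rfl⟩
      have h1 : Matrix.vecTail h ⬝ᵥ u = -h 0 := hu.2
      have h2 : Matrix.vecTail h ⬝ᵥ v = -h 0 := hv.2
      simp [dotProduct_sub, h1, h2]
    simpa using Submodule.finrank_lt hlt.ne
  refine ⟨_, _, hw, rfl, hP, F, ⟨Or.inr ⟨_, _, hw, hP, rfl⟩, ⟨y₀, hy₀⟩, ?_⟩, Set.inter_subset_right⟩
  rw [vectorSpan_upperHull hY, finrank_top, Module.finrank_fintype_fun_eq_card, Fintype.card_fin]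
  omega

/-! ### The upper hull as the intersection of its facet halfspaces -/

theorem convex_upperHull (Y : Set (Fin d → ℝ)) : Convex ℝ (upperHull Y) :=
  (convex_convexHull ℝ Y).add (convex_Ici (0 : Fin d → ℝ))

theorem isClosed_upperHull (hY : Y.Finite) : IsClosed (upperHull Y) :=
  IsClosed.add_left_of_isCompact (isClosed_Ici (a := (0 : Fin d → ℝ))) (hY.isCompact_convexHull ℝ)

theorem exists_dotProduct_eq {n : ℕ} (f : (Fin n → ℝ) →ₗ[ℝ] ℝ) :
    ∃ u : Fin n → ℝ, ∀ v, f v = u ⬝ᵥ v := by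
  refine ⟨fun i => f fun j => if i = j then 1 else 0, fun v => ?_⟩
  rw [LinearMap.pi_apply_eq_sum_univ f v]
  simp [dotProduct, mul_comm]

/-- A closed halfspace that is valid for `Y` and violated by `x` can be tilted until its boundary is
spanned by generators. -/
theorem IsGens.exists_tilt (hG : IsGens Y G) (hY : Y.Nonempty) (hGf : G.Finite)
    {x : Fin (d + 1) → ℝ} (n : ℕ) (hnn : ∀ g ∈ G, 0 ≤ h ⬝ᵥ toReal g) (hx : h ⬝ᵥ x < 0)
    (hn : d ≤ Module.finrank ℝ (Submodule.span ℝ (vanishing G h)) + n) :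
    ∃ h' : Fin (d + 1) → ℝ, (∀ g ∈ G, 0 ≤ h' ⬝ᵥ toReal g) ∧ h' ⬝ᵥ x < 0 ∧
      d ≤ Module.finrank ℝ (Submodule.span ℝ (vanishing G h')) := by
  induction n generalizing h with
  | zero => exact ⟨h, hnn, hx, hn⟩
  | succ n ih =>
    by_cases hd : d ≤ Module.finrank ℝ (Submodule.span ℝ (vanishing G h))
    · exact ⟨h, hnn, hx, hd⟩
    push Not at hd
    -- The tight generators together with `x` span at most `d` of the `d + 1` dimensions. A tilt
    -- along `u` keeps those generators tight and the value at `x` unchanged.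
    obtain ⟨u, hu0, huV, hux⟩ : ∃ u : Fin (d + 1) → ℝ, u ≠ 0 ∧
        (∀ v ∈ vanishing G h, u ⬝ᵥ v = 0) ∧ u ⬝ᵥ x = 0 := by
      set S := Submodule.span ℝ (vanishing G h) ⊔ Submodule.span ℝ {x}
      have hS : S < ⊤ := by
        refine lt_of_le_of_ne le_top fun htop => ?_
        have h1 := Submodule.finrank_add_le_finrank_add_finrank
          (Submodule.span ℝ (vanishing G h)) (Submodule.span ℝ {x})
        have h2 := h1.trans (Nat.add_le_add_left (finrank_span_singleton_le_one x) _)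
        have h3 : Module.finrank ℝ S = d + 1 := by rw [htop]; simp
        have h4 := h3.symm.trans_le h2
        omega
      obtain ⟨f, hf, hfS⟩ := Submodule.exists_le_ker_of_lt_top S hS
      obtain ⟨u, hu⟩ := exists_dotProduct_eq f
      refine ⟨u, ?_, fun v hv => ?_, ?_⟩
      · rintro rfl
        exact hf (LinearMap.ext fun v => by simp [hu])
      · rw [← hu]
        exact hfS (Submodule.mem_sup_left (Submodule.subset_span hv))
      · rw [← hu]
        exact hfS (Submodule.mem_sup_right (Submodule.mem_span_singleton_self x))
    -- After a change of sign, `u` is negative on some generator: otherwise it would vanish on all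
    -- generators, which span the space.
    obtain ⟨u, huV, hux, g₀, hg₀, hug₀⟩ : ∃ u : Fin (d + 1) → ℝ,
        (∀ v ∈ vanishing G h, u ⬝ᵥ v = 0) ∧ u ⬝ᵥ x = 0 ∧ ∃ g ∈ G, u ⬝ᵥ toReal g < 0 := by
      by_contra! hcon
      have h1 := hcon u huV hux
      have h2 := hcon (-u) (fun v hv => by simp [huV v hv]) (by simp [hux])
      have h3 : ∀ g ∈ G, u ⬝ᵥ toReal g = 0 := fun g hg => by
        have := h1 g hg
        have := h2 g hg
        rw [neg_dotProduct] at this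
        linarith
      have h4 : ∀ i : Fin d, u i.succ = 0 := fun i => by
        rw [← dotProduct_unitDir u i]; exact h3 _ (hG.dir i)
      obtain ⟨y, hy⟩ := hY
      obtain ⟨g, hg, hgy⟩ := hG.point y hy
      have h5 : Matrix.vecTail u = 0 := funext h4
      have h6 := h3 g hg
      rw [hgy.2, dotProduct_smul, dotProduct_vecCons, h5] at h6
      have h7 : u 0 = 0 := by simpa [hgy.1.ne'] using h6
      exact hu0 (funext fun j => Fin.cases h7 h4 j)
    -- Ratio test: `g₁` is a generator that becomes tight first, so at this step length all the
    -- others remain nonnegative.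
    obtain ⟨g₁, hg₁, hmin⟩ := Set.exists_min_image {g ∈ G | u ⬝ᵥ toReal g < 0}
      (fun g => (h ⬝ᵥ toReal g) / (-(u ⬝ᵥ toReal g))) (hGf.subset (Set.sep_subset _ _))
      ⟨g₀, hg₀, hug₀⟩
    have hug₁ : 0 < -(u ⬝ᵥ toReal g₁) := by linarith [hg₁.2]
    set t := (h ⬝ᵥ toReal g₁) / (-(u ⬝ᵥ toReal g₁)) with ht
    have ht0 : 0 ≤ t := div_nonneg (hnn _ hg₁.1) hug₁.le
    have htg₁ : (h + t • u) ⬝ᵥ toReal g₁ = 0 := by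
      rw [add_dotProduct, smul_dotProduct, smul_eq_mul]
      have : t * -(u ⬝ᵥ toReal g₁) = h ⬝ᵥ toReal g₁ := div_mul_cancel₀ _ hug₁.ne'
      linarith
    have hlt : Submodule.span ℝ (vanishing G h) < Submodule.span ℝ (vanishing G (h + t • u)) := by
      refine lt_of_le_of_ne (Submodule.span_mono ?_) fun heq => ?_
      · rintro v hv
        have h1 := huV v hv
        have h2 := vanishing_dotProduct hv
        obtain ⟨g, hg, rfl⟩ := hv
        exact ⟨g, ⟨hg.1, by rw [add_dotProduct, smul_dotProduct, h1, h2]; simp⟩, rfl⟩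
      · have hmem : toReal g₁ ∈ Submodule.span ℝ (vanishing G h) :=
          heq ▸ Submodule.subset_span ⟨g₁, ⟨hg₁.1, htg₁⟩, rfl⟩
        have := dotProduct_eq_zero_of_mem_span huV hmem
        linarith
    refine ih (h := h + t • u) (fun g hg => ?_) ?_ ?_
    · rw [add_dotProduct, smul_dotProduct, smul_eq_mul]
      have h1 := hnn g hg
      rcases le_or_gt 0 (u ⬝ᵥ toReal g) with h2 | h2
      · positivity
      · have h3 := hmin g ⟨hg, h2⟩
        rw [le_div_iff₀ (by linarith)] at h3
        linarith
    · rw [add_dotProduct, smul_dotProduct, hux]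
      simpa using hx
    · have := Submodule.finrank_lt_finrank_of_lt hlt
      omega

/-- The upper hull of a finite set is the intersection of its facet-supporting halfspaces. -/
theorem IsGens.mem_upperHull_of_forall_facet (hG : IsGens Y G) (hGf : G.Finite) (hY : Y.Nonempty)
    (hYf : Y.Finite) {z : Fin d → ℝ} (hz : ∀ H ∈ facetHalfspaces (upperHull Y), z ∈ H) :
    z ∈ upperHull Y := by
  by_contra hzP
  obtain ⟨f, c, hf, hfz⟩ := geometric_hahn_banach_closed_point (convex_upperHull Y)
    (isClosed_upperHull hYf) hzP
  obtain ⟨w, hw⟩ := exists_dotProduct_eq (f : (Fin d → ℝ) →ₗ[ℝ] ℝ)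
  have hw' : ∀ v, f v = w ⬝ᵥ v := hw
  have hP : upperHull Y ⊆ homHalfspace (Matrix.vecCons c (-w)) := fun v hv => by
    rw [mem_homHalfspace, dotProduct_vecCons]
    have := hf v hv
    rw [hw'] at this
    simp only [Matrix.cons_val_zero, mul_one, Matrix.tail_cons, neg_dotProduct]
    linarith
  have hlt : Matrix.vecCons c (-w) ⬝ᵥ Matrix.vecCons 1 z < 0 := by
    rw [dotProduct_vecCons]
    rw [hw'] at hfz
    simp only [Matrix.cons_val_zero, mul_one, Matrix.tail_cons, neg_dotProduct]
    linarith
  obtain ⟨h, hnn, hhz, hr⟩ := hG.exists_tilt hY hGf d (hG.nonneg_of_subset hY hP) hlt (by omega)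
  have h0 : h ≠ 0 := by rintro rfl; simp at hhz
  obtain ⟨T, hT, σ, hσ, μ, hμ, hTh⟩ := exists_crossVec h0 hr
  -- With zero weights `h` would take the same value at `z` and at a point of `Y`, although it is
  -- negative at `z` and nonnegative on `Y`.
  have htail : Matrix.vecTail h ≠ 0 := by
    intro h1
    obtain ⟨y, hy⟩ := hY
    have h2 := mem_homHalfspace.1 (hG.upperHull_subset hnn (subset_upperHull hy))
    rw [dotProduct_vecCons, h1] at h2 hhz
    simp only [zero_dotProduct] at h2 hhz
    linarith
  have hmem := hG.mem_facetHalfspaces hY hT hTh.symm (fun g hg => by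
      rw [smul_dotProduct]; exact mul_nonneg hμ.le (hnn g hg)) (fun h1 => htail (by
      funext i
      have := congrFun h1 i
      simpa [Matrix.vecTail, hμ.ne'] using this))
  rw [homHalfspace_smul hμ] at hmem
  exact absurd (mem_homHalfspace.1 (hz _ hmem)) (not_le.2 hhz)

theorem finite_candidates (G : Finset (Fin (d + 1) → ℤ)) :
    (candidates (G : Set (Fin (d + 1) → ℤ))).Finite ∧
      (candidates (G : Set (Fin (d + 1) → ℤ))).ncard ≤ 2 * G.card ^ d := by
  classical
  have hsub : candidates (G : Set (Fin (d + 1) → ℤ)) ⊆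
      (((({1, -1} : Finset ℤ) ×ˢ Fintype.piFinset fun _ : Fin d => G).image
        fun p => homHalfspace (toReal (p.1 • crossVec p.2)) : Finset (Set (Fin d → ℝ))) :
          Set (Set (Fin d → ℝ))) := by
    rintro _ ⟨T, hT, σ, hσ, rfl⟩
    rw [Finset.coe_image]
    exact ⟨(σ, T), by simpa [hσ] using hT, rfl⟩
  refine ⟨(Finset.finite_toSet _).subset hsub, (Set.ncard_le_ncard hsub (Finset.finite_toSet _)).trans ?_⟩
  rw [Set.ncard_coe_finset]
  refine Finset.card_image_le.trans ?_
  simp [Finset.card_product]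

end

/-! ## Rational scalar products as fractions of integers -/

/-- Numerator and denominator, not reduced, of `∑ k < i, u k * v k`. -/
def fracSum (u v : ℕ → ℚ) : ℕ → ℤ × ℤ
  | 0 => (0, 1)
  | i + 1 => ((fracSum u v i).1 * ((u i).den * (v i).den) +
      (u i).num * (v i).num * (fracSum u v i).2, (fracSum u v i).2 * ((u i).den * (v i).den))

theorem fracSum_snd_pos (u v : ℕ → ℚ) (i : ℕ) : 0 < (fracSum u v i).2 := by
  induction i with
  | zero => simp [fracSum]
  | succ i ih =>
    have h1 : (0 : ℤ) < (u i).den := by exact_mod_cast (u i).den_pos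
    have h2 : (0 : ℤ) < (v i).den := by exact_mod_cast (v i).den_pos
    simp only [fracSum]
    positivity

theorem fracSum_fst_eq (u v : ℕ → ℚ) (i : ℕ) :
    ((fracSum u v i).1 : ℚ) = (∑ k ∈ Finset.range i, u k * v k) * (fracSum u v i).2 := by
  induction i with
  | zero => simp [fracSum]
  | succ i ih =>
    rw [Finset.sum_range_succ]
    simp only [fracSum]
    push_cast
    rw [ih]
    have h1 : ((u i).num : ℚ) = u i * (u i).den := (Rat.mul_den_eq_num _).symm
    have h2 : ((v i).num : ℚ) = v i * (v i).den := (Rat.mul_den_eq_num _).symm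
    rw [h1, h2]
    ring

theorem BData.natAbs_num_le (q : ℚ) : q.num.natAbs ≤ 2 ^ (ofRat q).size := by
  have : q.num.natAbs < 2 ^ (ofRat q).size := by
    rw [← Nat.size_le]; simp only [ofRat, size]; omega
  exact this.le

theorem BData.den_le (q : ℚ) : q.den ≤ 2 ^ (ofRat q).size := by
  have : q.den < 2 ^ (ofRat q).size := by
    rw [← Nat.size_le]; simp only [ofRat, size, Int.natAbs_natCast]; omega
  exact this.le

/-- One step multiplies the bound by `2 * 2^B * 2^B`: the numerator is a sum of two terms, each with
two new factors of size at most `2^B`. Without reduction the bit length thus stays linear in `i`. -/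
theorem fracSum_le {u v : ℕ → ℚ} {B i : ℕ} (hu : ∀ k < i, (BData.ofRat (u k)).size ≤ B)
    (hv : ∀ k < i, (BData.ofRat (v k)).size ≤ B) :
    (fracSum u v i).1.natAbs ≤ 2 ^ ((2 * B + 1) * i) ∧
      (fracSum u v i).2.natAbs ≤ 2 ^ ((2 * B + 1) * i) := by
  induction i with
  | zero => simp [fracSum]
  | succ i ih =>
    obtain ⟨h1, h2⟩ := ih (fun k hk => hu k (by omega)) (fun k hk => hv k (by omega))
    have hp : ∀ q : ℚ, (BData.ofRat q).size ≤ B → q.num.natAbs ≤ 2 ^ B ∧ q.den ≤ 2 ^ B :=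
      fun q hq => ⟨(BData.natAbs_num_le q).trans (Nat.pow_le_pow_right (by norm_num) hq),
        (BData.den_le q).trans (Nat.pow_le_pow_right (by norm_num) hq)⟩
    obtain ⟨hun, hud⟩ := hp _ (hu i (by omega))
    obtain ⟨hvn, hvd⟩ := hp _ (hv i (by omega))
    have hpow : 2 ^ ((2 * B + 1) * (i + 1)) = 2 ^ ((2 * B + 1) * i) * (2 ^ B * 2 ^ B) +
        2 ^ B * 2 ^ B * 2 ^ ((2 * B + 1) * i) := by ring
    have hden : ((fracSum u v i).2 * ((u i).den * (v i).den)).natAbs ≤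
        2 ^ ((2 * B + 1) * i) * (2 ^ B * 2 ^ B) := by
      simp only [Int.natAbs_mul, Int.natAbs_natCast]
      gcongr
    refine ⟨?_, hden.trans (hpow ▸ Nat.le_add_right _ _)⟩
    rw [hpow]
    refine (Int.natAbs_add_le _ _).trans ?_
    simp only [Int.natAbs_mul, Int.natAbs_natCast]
    gcongr

/-- Extension of a vector by zero. -/
def pad {n : ℕ} (v : Fin n → ℚ) (k : ℕ) : ℚ := if h : k < n then v ⟨k, h⟩ else 0

theorem pad_coe {n : ℕ} (v : Fin n → ℚ) (k : Fin n) : pad v k = v k := by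
  simp [pad]

theorem BData.size_pad_le {n : ℕ} (v : Fin n → ℚ) {k : ℕ} (hk : k < n) :
    (ofRat (pad v k)).size ≤ (ofVec v).size := by
  rw [pad, dif_pos hk]
  exact size_le_size_ofList (List.mem_ofFn.2 ⟨⟨k, hk⟩, rfl⟩)

theorem BData.le_size_ofVec {n : ℕ} (v : Fin n → ℚ) : n ≤ (ofVec v).size := by
  simpa [ofVec] using length_le_size_ofList (List.ofFn fun k => ofRat (v k))

theorem BData.size_row_le {m n : ℕ} (M : Matrix (Fin m) (Fin n) ℚ) (j : Fin m) :
    (ofVec (M j)).size ≤ (ofMat M).size :=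
  size_le_size_ofList (List.mem_ofFn.2 ⟨j, rfl⟩)

/-! ## The inner approximation algorithm: bounds and correctness -/

namespace MOMILP

variable {d : ℕ} (M : MOMILP d)

/-- The `j`-th objective value of `x` as a fraction. -/
def objFrac (x : Fin M.n → ℚ) (j : Fin d) : ℤ × ℤ := fracSum (pad (M.Q j)) (pad x) M.n

theorem objFrac_snd_pos (x : Fin M.n → ℚ) (j : Fin d) : 0 < (M.objFrac x j).2 :=
  fracSum_snd_pos _ _ _

theorem objFrac_fst_eq (x : Fin M.n → ℚ) (j : Fin d) :
    ((M.objFrac x j).1 : ℝ) = M.f (castVec x) j * (M.objFrac x j).2 := by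
  have h := fracSum_fst_eq (pad (M.Q j)) (pad x) M.n
  rw [← Fin.sum_univ_eq_sum_range fun k => pad (M.Q j) k * pad x k] at h
  simp only [pad_coe] at h
  have h' := congrArg (fun q : ℚ => (q : ℝ)) h
  push_cast at h'
  exact h'

theorem objFrac_le {x : Fin M.n → ℚ} (j : Fin d) {B : ℕ} (hQ : (BData.ofMat M.Q).size ≤ B)
    (hx : (BData.ofVec x).size ≤ B) :
    (M.objFrac x j).1.natAbs ≤ 2 ^ ((2 * B + 1) * B) ∧
      (M.objFrac x j).2.natAbs ≤ 2 ^ ((2 * B + 1) * B) := by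
  have hn : M.n ≤ B := (BData.le_size_ofVec x).trans hx
  have h := fracSum_le (u := pad (M.Q j)) (v := pad x) (B := B) (i := M.n)
    (fun k hk => (BData.size_pad_le _ hk).trans ((BData.size_row_le M.Q j).trans hQ))
    (fun k hk => (BData.size_pad_le _ hk).trans hx)
  have hp : 2 ^ ((2 * B + 1) * M.n) ≤ 2 ^ ((2 * B + 1) * B) :=
    Nat.pow_le_pow_right (by norm_num) (Nat.mul_le_mul_left _ hn)
  exact ⟨h.1.trans hp, h.2.trans hp⟩

/-- Integral homogeneous coordinates of the image of `x`. -/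
def homPoint (x : Fin M.n → ℚ) : Fin (d + 1) → ℤ :=
  Matrix.vecCons (∏ i, (M.objFrac x i).2)
    fun j => (M.objFrac x j).1 * ∏ i ∈ Finset.univ.erase j, (M.objFrac x i).2

theorem homPoint_zero_pos (x : Fin M.n → ℚ) : 0 < M.homPoint x 0 := by
  rw [homPoint, Matrix.cons_val_zero]
  exact Finset.prod_pos fun i _ => M.objFrac_snd_pos x i

theorem homPoint_succ (x : Fin M.n → ℚ) (j : Fin d) :
    (M.homPoint x j.succ : ℝ) = M.homPoint x 0 * M.f (castVec x) j := by
  simp only [homPoint, Matrix.cons_val_succ, Matrix.cons_val_zero]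
  rw [← Finset.mul_prod_erase _ _ (Finset.mem_univ j)]
  push_cast
  rw [objFrac_fst_eq]
  ring

theorem represents_homPoint (x : Fin M.n → ℚ) :
    Represents (M.homPoint x) (M.f (castVec x)) := by
  refine ⟨M.homPoint_zero_pos x, funext fun j => ?_⟩
  refine Fin.cases ?_ (fun j => ?_) j
  · simp [toReal]
  · simp [toReal, homPoint_succ]

/-- The generators that belong to the solutions found so far. -/
noncomputable def gens (R : Finset (Fin M.n → ℚ)) : Finset (Fin (d + 1) → ℤ) :=
  open Classical in R.image M.homPoint ∪ Finset.univ.image unitDir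

theorem mem_gens {R : Finset (Fin M.n → ℚ)} {g : Fin (d + 1) → ℤ} :
    g ∈ M.gens R ↔ (∃ x ∈ R, M.homPoint x = g) ∨ ∃ i, unitDir i = g := by
  simp [gens]

theorem card_gens_le (R : Finset (Fin M.n → ℚ)) : (M.gens R).card ≤ R.card + d := by
  refine (Finset.card_union_le _ _).trans (add_le_add Finset.card_image_le ?_)
  simpa using Finset.card_image_le (s := (Finset.univ : Finset (Fin d))) (f := unitDir)

/-- The images of the solutions found so far. -/
def images (R : Finset (Fin M.n → ℚ)) : Set (Fin d → ℝ) := (fun x => M.f (castVec x)) '' R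

theorem innerPoly_eq (R : Finset (Fin M.n → ℚ)) : M.innerPoly R = upperHull (M.images R) := rfl

theorem isGens_gens (R : Finset (Fin M.n → ℚ)) : IsGens (M.images R) (M.gens R) where
  cases g hg := by
    rcases M.mem_gens.1 hg with ⟨x, hx, rfl⟩ | ⟨i, rfl⟩
    · exact Or.inl ⟨_, ⟨x, hx, rfl⟩, M.represents_homPoint x⟩
    · exact Or.inr ⟨i, rfl⟩
  point := by
    rintro _ ⟨x, hx, rfl⟩
    exact ⟨_, M.mem_gens.2 (Or.inl ⟨x, hx, rfl⟩), M.represents_homPoint x⟩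
  dir i := M.mem_gens.2 (Or.inr ⟨i, rfl⟩)

theorem images_nonempty {R : Finset (Fin M.n → ℚ)} {x : Fin M.n → ℚ} (hx : x ∈ R) :
    (M.images R).Nonempty := ⟨_, x, hx, rfl⟩

theorem images_finite (R : Finset (Fin M.n → ℚ)) : (M.images R).Finite :=
  R.finite_toSet.image _

theorem cast_dotProduct_mulVec (w : Fin d → ℚ) (x : Fin M.n → ℚ) :
    ((w ⬝ᵥ (M.Q *ᵥ x) : ℚ) : ℝ) = castVec w ⬝ᵥ M.f (castVec x) := by
  simp [dotProduct, Matrix.mulVec, castVec, f]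

theorem castVec_smul {n : ℕ} (q : ℚ) (w : Fin n → ℚ) : castVec (q • w) = (q : ℝ) • castVec w := by
  ext; simp [castVec]

/-- The facts on a run of the algorithm that are preserved by its iterations. -/
structure RunInv (WS : (Fin d → ℚ) → (Fin M.n → ℚ)) (ε : ℚ) (x₀ : Fin M.n → ℚ) (k : ℕ)
    (S : M.State) : Prop where
  mem : x₀ ∈ S.R
  feasible : ∀ x ∈ S.R, castVec x ∈ M.X
  finite : S.F.Finite
  card : S.R.card + S.F.ncard = k + 1
  out : ∀ x ∈ S.R, x ≠ x₀ → ∃ w, 0 ≤ w ∧ x = WS w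
  far : ∀ x ∈ S.R, ∀ y ∈ S.R, x ≠ y → ¬ (M.f (castVec x) ≤ (1 + ε : ℝ) • M.f (castVec y) ∧
    M.f (castVec y) ≤ (1 + ε : ℝ) • M.f (castVec x))
  cand : S.F ⊆ candidates (M.gens S.R)
  inside : ∀ H ∈ S.F, ∀ x ∈ M.X, (1 + ε : ℝ) • M.f x ∈ H

/-! ### Preservation of the invariants, and their consequences -/

variable {M} {WS : (Fin d → ℚ) → (Fin M.n → ℚ)} {ε : ℚ} {x₀ : Fin M.n → ℚ}

theorem halfspace_weight_nonneg {R : Finset (Fin M.n → ℚ)} (hx₀ : x₀ ∈ R) {w : Fin d → ℚ} {c : ℚ}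
    (hH : halfspace (castVec w) (c : ℝ) ∈ facetHalfspaces (M.innerPoly R)) :
    0 ≤ w ∧ ∀ x ∈ R, (c : ℝ) ≤ castVec w ⬝ᵥ M.f (castVec x) := by
  obtain ⟨w', c', -, -, hP, -⟩ := hH
  refine ⟨fun i => ?_, fun x hx => hP (subset_upperHull ⟨x, hx, rfl⟩)⟩
  have := nonneg_of_upperHull_subset (M.images_nonempty hx₀) hP i
  simpa [castVec] using this

theorem RunInv.step (hopt : ∀ w, 0 ≤ w → M.IsWSOptimal w (WS w))
    (hnn : ∀ x ∈ M.X, 0 ≤ M.f x) (hε : 0 < ε) {k : ℕ} {S S' : M.State}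
    (h : M.RunInv WS ε x₀ k S) (hS : M.Step (M.hpOWS WS) ε S S') :
    M.RunInv WS ε x₀ (k + 1) S' := by
  classical
  have hεR : (0 : ℝ) < ε := by exact_mod_cast hε
  cases hS with
  | @notInside w c x hH hx =>
    obtain ⟨hw, hc⟩ := halfspace_weight_nonneg h.mem hH.1
    have hw' : 0 ≤ (1 + ε) • w := smul_nonneg (by positivity) hw
    have hwR : 0 ≤ castVec w := fun i => by simpa [castVec] using hw i
    simp only [hpOWS] at hx
    split_ifs at hx with hlt
    obtain rfl : WS ((1 + ε) • w) = x := by simpa using hx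
    have hopt' := hopt _ hw'
    set x := WS ((1 + ε) • w) with hxdef
    have hlt' : (1 + ε : ℝ) * (castVec w ⬝ᵥ M.f (castVec x)) < c := by
      have h1 : (((1 + ε) • w ⬝ᵥ (M.Q *ᵥ x) : ℚ) : ℝ) < (c : ℝ) := by
        exact_mod_cast not_le.1 hlt
      rw [cast_dotProduct_mulVec, castVec_smul, smul_dotProduct] at h1
      simpa using h1
    -- Otherwise pairing with `w ≥ 0` gives `c ≤ w·f(y) ≤ (1+ε) w·f(x) < c`.
    have hfar : ∀ y ∈ S.R, ¬ M.f (castVec y) ≤ (1 + ε : ℝ) • M.f (castVec x) := by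
      intro y hy hle
      have h1 := dotProduct_le_dotProduct_of_nonneg_left hle hwR
      rw [dotProduct_smul, smul_eq_mul] at h1
      linarith [hc y hy]
    -- Since `f(x) ≥ 0` implies `f(x) ≤ (1+ε) f(x)`, the previous fact excludes `y = x`; the
    -- solution is new and `R` really grows.
    have hnot : x ∉ S.R := by
      intro hmem
      refine hfar x hmem ?_
      rw [add_smul, one_smul]
      exact le_add_of_nonneg_right (smul_nonneg hεR.le (hnn _ hopt'.1))
    exact {
      mem := Finset.mem_insert_of_mem h.mem
      feasible := by
        intro y hy
        rcases Finset.mem_insert.1 hy with rfl | hy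
        · exact hopt'.1
        · exact h.feasible y hy
      finite := h.finite
      card := by
        have := h.card
        rw [Finset.card_insert_of_notMem hnot]
        dsimp only
        omega
      out := by
        intro y hy hne
        rcases Finset.mem_insert.1 hy with rfl | hy
        · exact ⟨_, hw', hxdef⟩
        · exact h.out y hy hne
      far := by
        intro y hy z hz hne hyz
        rcases Finset.mem_insert.1 hy with rfl | hy
        · rcases Finset.mem_insert.1 hz with rfl | hz
          · exact hne rfl
          · exact hfar z hz hyz.2
        · rcases Finset.mem_insert.1 hz with rfl | hz
          · exact hfar y hy hyz.1
          · exact h.far y hy z hz hne hyz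
      -- Enlarging `R` only adds candidates. A settled halfspace may cease to support a facet, but
      -- it is still counted.
      cand := by
        intro H hH
        obtain ⟨T, hT, hT'⟩ := h.cand hH
        refine ⟨T, fun i => ?_, hT'⟩
        refine M.mem_gens.2 ((M.mem_gens.1 (hT i)).imp_left ?_)
        rintro ⟨y, hy, hy'⟩
        exact ⟨y, Finset.mem_insert_of_mem hy, hy'⟩
      inside := h.inside }
  | @inside w c hH hx =>
    obtain ⟨hw, hc⟩ := halfspace_weight_nonneg h.mem hH.1
    have hw' : 0 ≤ (1 + ε) • w := smul_nonneg (by positivity) hw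
    simp only [hpOWS] at hx
    split_ifs at hx with hle
    exact {
      mem := h.mem
      feasible := h.feasible
      finite := h.finite.insert _
      card := by
        have := h.card
        rw [Set.ncard_insert_of_notMem hH.2 h.finite]
        dsimp only
        omega
      out := h.out
      far := h.far
      cand := by
        refine Set.insert_subset ?_ h.cand
        exact (M.isGens_gens S.R).facetHalfspaces_subset (M.images_nonempty h.mem) hH.1
      inside := by
        intro H hH' y hy
        rcases Set.mem_insert_iff.1 hH' with rfl | hH'
        · have h1 : (c : ℝ) ≤ (((1 + ε) • w ⬝ᵥ (M.Q *ᵥ WS ((1 + ε) • w)) : ℚ) : ℝ) := by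
            exact_mod_cast hle
          rw [cast_dotProduct_mulVec] at h1
          have h2 := (hopt _ hw').2 y hy
          rw [halfspace, Set.mem_ofPred_eq, dotProduct_smul, smul_eq_mul]
          have h3 : castVec ((1 + ε) • w) ⬝ᵥ M.f y = (1 + ε : ℝ) * (castVec w ⬝ᵥ M.f y) := by
            rw [castVec_smul, smul_dotProduct]; simp
          linarith
        · exact h.inside H hH' y hy }

theorem Reaches.runInv (hopt : ∀ w, 0 ≤ w → M.IsWSOptimal w (WS w))
    (hnn : ∀ x ∈ M.X, 0 ≤ M.f x) (hε : 0 < ε) (hx₀ : castVec x₀ ∈ M.X) {k : ℕ} {S : M.State}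
    (h : M.Reaches (M.hpOWS WS) ε x₀ k S) : M.RunInv WS ε x₀ k S := by
  induction h with
  | init =>
    exact {
      mem := Finset.mem_singleton_self _
      feasible := by simpa using hx₀
      finite := Set.finite_empty
      card := by simp
      out := by simp
      far := by
        intro x hx y hy hne
        exact absurd ((Finset.mem_singleton.1 hx).trans (Finset.mem_singleton.1 hy).symm) hne
      cand := Set.empty_subset _
      inside := by simp }
  | step _ hS ih => exact ih.step hopt hnn hε hS

theorem RunInv.isConvexApproxSet {k : ℕ} {S : M.State} (h : M.RunInv WS ε x₀ k S)
    (hS : S.IsFinal) : M.IsConvexApproxSet ε (castVec '' (S.R : Set (Fin M.n → ℚ))) := by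
  refine ⟨?_, fun x hx => ?_⟩
  · rintro _ ⟨x, hx, rfl⟩
    exact h.feasible x hx
  · have hmem : (1 + ε : ℝ) • M.f x ∈ upperHull (M.images S.R) := by
      refine (M.isGens_gens S.R).mem_upperHull_of_forall_facet (Finset.finite_toSet _)
        (M.images_nonempty h.mem) (M.images_finite _) fun H hH => ?_
      refine h.inside H ?_ x hx
      by_contra hHF
      exact Set.notMem_empty H (hS ▸ (⟨hH, hHF⟩ : H ∈ facetHalfspaces (M.innerPoly S.R) \ S.F))
    obtain ⟨v, hv, z, hz, hvz⟩ := hmem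
    refine ⟨v, by rwa [Set.image_image], ?_⟩
    rw [← hvz]
    exact le_add_of_nonneg_right hz

/-- `Step` requires a rational representation of the halfspace, and the cross product of integral
generators provides an integral one. -/
theorem RunInv.exists_step {k : ℕ} {S : M.State} (h : M.RunInv WS ε x₀ k S) (hS : ¬ S.IsFinal) :
    ∃ S', M.Step (M.hpOWS WS) ε S S' := by
  obtain ⟨H, hH⟩ := Set.nonempty_iff_ne_empty.2 hS
  obtain ⟨T, -, σ, -, hHT⟩ :=
    (M.isGens_gens S.R).facetHalfspaces_subset (M.images_nonempty h.mem) hH.1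
  set w : Fin d → ℚ := fun i => ((σ • crossVec T) i.succ : ℤ)
  set c : ℚ := -((σ • crossVec T) 0 : ℤ)
  have hw : H = halfspace (castVec w) (c : ℝ) := by
    have h1 : castVec w = Matrix.vecTail (toReal (σ • crossVec T)) := by
      ext i; simp [w, castVec, toReal, Matrix.vecTail]
    have h2 : (c : ℝ) = -toReal (σ • crossVec T) 0 := by simp [c, toReal]
    rw [hHT, homHalfspace, h1, h2]
  rw [hw] at hH
  rcases hx : M.hpOWS WS ((1 + ε) • w) c with _ | x
  · exact ⟨_, .inside hH hx⟩
  · exact ⟨_, .notInside hH hx⟩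

/-- The interval from `2 ^ (-E)` to `2 ^ E` is covered by few intervals of ratio `1 + ε`. -/
theorem exists_box {ε : ℝ} (hε : 0 < ε) (E m : ℕ) (hm : 2 ≤ (1 + ε) ^ m) :
    ∃ β : ℝ → ℕ, ∀ y, (y = 0 ∨ 1 ≤ y * 2 ^ E ∧ y ≤ 2 ^ E) → β y < 2 * E * m + 2 ∧
      ∀ y', (y' = 0 ∨ 1 ≤ y' * 2 ^ E ∧ y' ≤ 2 ^ E) → β y = β y' → y ≤ (1 + ε) * y' := by
  have hpow : ∀ y, ∃ n : ℕ, 1 ≤ y * 2 ^ E → (1 + ε) ^ n ≤ y * 2 ^ E ∧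
      y * 2 ^ E < (1 + ε) ^ (n + 1) := fun y => by
    by_cases hy : 1 ≤ y * 2 ^ E
    · obtain ⟨n, hn⟩ := exists_nat_pow_near hy (by linarith : 1 < 1 + ε)
      exact ⟨n, fun _ => hn⟩
    · exact ⟨0, fun h => absurd h hy⟩
  choose ν hν using hpow
  have hE : (0 : ℝ) < 2 ^ E := by positivity
  -- Box `0` is reserved for the value `0`; a positive `y` goes to the integer part of the logarithm
  -- of `y * 2^E` to base `1+ε`, shifted by one.
  refine ⟨fun y => if y = 0 then 0 else ν y + 1, fun y hy => ⟨?_, fun y' hy' hyy' => ?_⟩⟩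
  · dsimp only
    split_ifs with h0
    · omega
    · obtain ⟨h1, h2⟩ := hy.resolve_left h0
      have h3 : (1 + ε) ^ ν y ≤ (1 + ε) ^ (m * (2 * E)) := by
        calc (1 + ε) ^ ν y ≤ y * 2 ^ E := (hν y h1).1
          _ ≤ 2 ^ E * 2 ^ E := by gcongr
          _ = 2 ^ (2 * E) := by rw [← pow_add]; congr 1; omega
          _ ≤ ((1 + ε) ^ m) ^ (2 * E) := by gcongr
          _ = (1 + ε) ^ (m * (2 * E)) := by rw [← pow_mul]
      have h4 := (pow_le_pow_iff_right₀ (by linarith : 1 < 1 + ε)).1 h3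
      have h5 : m * (2 * E) = 2 * E * m := by ring
      omega
  · dsimp only at hyy'
    rcases eq_or_ne y 0 with rfl | h0
    · rcases eq_or_ne y' 0 with rfl | h0'
      · simp
      · simp [h0'] at hyy'
    · rcases eq_or_ne y' 0 with rfl | h0'
      · simp [h0] at hyy'
      · simp only [h0, h0', if_false, Nat.add_right_cancel_iff] at hyy'
        have h1 := hν y (hy.resolve_left h0).1
        have h2 := hν y' (hy'.resolve_left h0').1
        rw [hyy', pow_succ] at h1
        have h3 : y * 2 ^ E ≤ ((1 + ε) * y') * 2 ^ E := by
          have := mul_le_mul_of_nonneg_right h2.1 (by linarith : 0 ≤ 1 + ε)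
          linarith
        exact le_of_mul_le_mul_right h3 hE

/-- The value is a fraction whose nonnegative numerator and positive denominator are integers of
size at most `2^E`; if it is nonzero, both are at least `1`. -/
theorem f_bounds (hnn : ∀ x ∈ M.X, 0 ≤ M.f x) {x : Fin M.n → ℚ} (hx : castVec x ∈ M.X) {B : ℕ}
    (hQ : (BData.ofMat M.Q).size ≤ B) (hxB : (BData.ofVec x).size ≤ B) (j : Fin d) :
    M.f (castVec x) j = 0 ∨ 1 ≤ M.f (castVec x) j * 2 ^ ((2 * B + 1) * B) ∧
      M.f (castVec x) j ≤ 2 ^ ((2 * B + 1) * B) := by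
  set y := M.f (castVec x) j with hy
  have hy0 : 0 ≤ y := hnn _ hx j
  have hD := M.objFrac_snd_pos x j
  have hN := M.objFrac_fst_eq x j
  obtain ⟨h1, h2⟩ := M.objFrac_le j hQ hxB
  rw [← hy] at hN
  set N := (M.objFrac x j).1
  set D := (M.objFrac x j).2
  set E := (2 * B + 1) * B
  have hDR : (1 : ℝ) ≤ D := by exact_mod_cast hD
  have hN0 : 0 ≤ N := by
    have : (0 : ℝ) ≤ N := by rw [hN]; positivity
    exact_mod_cast this
  have h1R : (N : ℝ) ≤ 2 ^ E := by
    have : (N : ℤ) ≤ 2 ^ E := by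
      rw [← Int.natAbs_of_nonneg hN0]; exact_mod_cast h1
    exact_mod_cast this
  have h2R : (D : ℝ) ≤ 2 ^ E := by
    have : (D : ℤ) ≤ 2 ^ E := by
      rw [← Int.natAbs_of_nonneg hD.le]; exact_mod_cast h2
    exact_mod_cast this
  rcases eq_or_lt_of_le hy0 with h0 | h0
  · exact Or.inl h0.symm
  · right
    have hN1 : (1 : ℝ) ≤ N := by
      have : (0 : ℝ) < N := by rw [hN]; positivity
      exact_mod_cast (by exact_mod_cast this : 0 < N)
    constructor
    · calc (1 : ℝ) ≤ y * D := by rw [← hN]; exact hN1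
        _ ≤ y * 2 ^ E := by gcongr
    · calc y ≤ y * D := le_mul_of_one_le_right hy0 hDR
        _ ≤ 2 ^ E := by rw [← hN]; exact h1R

/-- Bernoulli's inequality. -/
theorem two_le_one_add_pow {ε : ℚ} (hε : 0 < ε) : (2 : ℝ) ≤ (1 + (ε : ℝ)) ^ ⌈ε⁻¹⌉₊ := by
  have hεR : (0 : ℝ) < ε := by exact_mod_cast hε
  have h1 := one_add_mul_le_pow (by linarith : (-2 : ℝ) ≤ ε) ⌈ε⁻¹⌉₊
  have h2 : (ε : ℝ)⁻¹ ≤ (⌈ε⁻¹⌉₊ : ℝ) := by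
    have := Nat.le_ceil ε⁻¹
    exact_mod_cast this
  have h3 : 1 ≤ (⌈ε⁻¹⌉₊ : ℝ) * ε := by
    have := mul_le_mul_of_nonneg_right h2 hεR.le
    rwa [inv_mul_cancel₀ hεR.ne'] at this
  linarith

/-- A bound on the number of solutions found, when all of them have encoding length at most `B`. -/
def solBound (d B m : ℕ) : ℕ := (2 * ((2 * B + 1) * B) * m + 2) ^ d + 1

/-- Two solutions in the same box approximate each other within the factor `1+ε`, contrary to `far`.
The initial solution is set aside because its encoding length is arbitrary; it accounts for the `+
1` in `solBound`. -/
theorem RunInv.card_R_le (hopt : ∀ w, 0 ≤ w → M.IsWSOptimal w (WS w))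
    (hnn : ∀ x ∈ M.X, 0 ≤ M.f x) (hε : 0 < ε) {B : ℕ} (hQ : (BData.ofMat M.Q).size ≤ B)
    (hB : ∀ w, 0 ≤ w → (BData.ofVec (WS w)).size ≤ B) {k : ℕ} {S : M.State}
    (h : M.RunInv WS ε x₀ k S) : S.R.card ≤ solBound d B ⌈ε⁻¹⌉₊ := by
  classical
  have hεR : (0 : ℝ) < ε := by exact_mod_cast hε
  obtain ⟨β, hβ⟩ := exists_box hεR ((2 * B + 1) * B) ⌈ε⁻¹⌉₊ (two_le_one_add_pow hε)
  have hb : ∀ x ∈ S.R.erase x₀, ∀ j, M.f (castVec x) j = 0 ∨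
      1 ≤ M.f (castVec x) j * 2 ^ ((2 * B + 1) * B) ∧
        M.f (castVec x) j ≤ 2 ^ ((2 * B + 1) * B) := by
    intro x hx j
    obtain ⟨hne, hx⟩ := Finset.mem_erase.1 hx
    obtain ⟨w, hw, rfl⟩ := h.out x hx hne
    exact f_bounds hnn (hopt w hw).1 hQ (hB w hw) j
  have hcard : (S.R.erase x₀).card ≤
      (Fintype.piFinset fun _ : Fin d =>
        Finset.range (2 * ((2 * B + 1) * B) * ⌈ε⁻¹⌉₊ + 2)).card := by
    refine Finset.card_le_card_of_injOn (fun x j => β (M.f (castVec x) j)) (fun x hx => ?_) ?_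
    · rw [Finset.mem_coe, Fintype.mem_piFinset]
      exact fun j => Finset.mem_range.2 (hβ _ (hb x hx j)).1
    · intro x hx y hy hxy
      by_contra hne
      refine h.far x (Finset.mem_of_mem_erase hx) y (Finset.mem_of_mem_erase hy) hne
        ⟨fun j => ?_, fun j => ?_⟩
      · exact (hβ _ (hb x hx j)).2 _ (hb y hy j) (congrFun hxy j)
      · exact (hβ _ (hb y hy j)).2 _ (hb x hx j) (congrFun hxy j).symm
  have := Finset.card_erase_add_one h.mem
  rw [Fintype.card_piFinset_const, Finset.card_range] at hcard
  rw [solBound]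
  omega

theorem RunInv.iter_le (hopt : ∀ w, 0 ≤ w → M.IsWSOptimal w (WS w))
    (hnn : ∀ x ∈ M.X, 0 ≤ M.f x) (hε : 0 < ε) {B : ℕ} (hQ : (BData.ofMat M.Q).size ≤ B)
    (hB : ∀ w, 0 ≤ w → (BData.ofVec (WS w)).size ≤ B) {k : ℕ} {S : M.State}
    (h : M.RunInv WS ε x₀ k S) :
    k ≤ solBound d B ⌈ε⁻¹⌉₊ + 2 * (solBound d B ⌈ε⁻¹⌉₊ + d) ^ d := by
  have h1 := h.card_R_le hopt hnn hε hQ hB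
  obtain ⟨hf, hc⟩ := finite_candidates (M.gens S.R)
  have h2 : S.F.ncard ≤ 2 * (solBound d B ⌈ε⁻¹⌉₊ + d) ^ d :=
    calc S.F.ncard ≤ _ := Set.ncard_le_ncard h.cand hf
      _ ≤ 2 * (M.gens S.R).card ^ d := hc
      _ ≤ 2 * (solBound d B ⌈ε⁻¹⌉₊ + d) ^ d := by
        have := M.card_gens_le S.R
        gcongr
        omega
  have := h.card
  omega

end MOMILP

/-! ### The iteration bound as a polynomial in the input -/

namespace MOProblem

variable {d : ℕ} (P : MOProblem d)
  {WS : ∀ I : P.Inst, (Fin d → ℚ) → (Fin (P.toMOMILP I).n → ℚ)}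

theorem size_Q_le (I : P.Inst) : (BData.ofMat (P.toMOMILP I).Q).size ≤ (P.enc I).size := by
  rw [enc, BData.size_pair]; omega

/-- The number of iterations is polynomially bounded. -/
theorem exists_iter_bound (hWS : P.IsPolyTimeWS WS) :
    ∃ p : Polynomial ℕ, ∀ (I : P.Inst) (ε : ℚ), 0 < ε → ∀ x₀ : Fin (P.toMOMILP I).n → ℚ,
      castVec x₀ ∈ (P.toMOMILP I).X → ∀ (k : ℕ) (S : (P.toMOMILP I).State),
      (P.toMOMILP I).Reaches ((P.toMOMILP I).hpOWS (WS I)) ε x₀ k S →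
        k ≤ p.eval ((P.enc I).size + ⌈ε⁻¹⌉₊) := by
  obtain ⟨hopt, ⟨q, hq⟩, -⟩ := hWS
  have hbd : PolyBdd (fun s : ℕ => s) fun s => MOMILP.solBound d (s + q.eval s) s +
      2 * (MOMILP.solBound d (s + q.eval s) s + d) ^ d := by
    have h1 : PolyBdd (fun s : ℕ => s) fun s => s + q.eval s := PolyBdd.self.add (PolyBdd.self.eval q)
    have h2 : PolyBdd (fun s : ℕ => s) fun s => MOMILP.solBound d (s + q.eval s) s :=
      (((((PolyBdd.const 2).mul ((((PolyBdd.const 2).mul h1).add (PolyBdd.const 1)).mul h1)).mul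
        PolyBdd.self).add (PolyBdd.const 2)).pow d).add (PolyBdd.const 1)
    exact h2.add ((PolyBdd.const 2).mul ((h2.add (PolyBdd.const d)).pow d))
  obtain ⟨p, hp⟩ := hbd
  refine ⟨p, fun I ε hε x₀ hx₀ k S hS => ?_⟩
  set s := (P.enc I).size + ⌈ε⁻¹⌉₊ with hs
  have h1 := (hS.runInv (hopt I) (P.nonneg I) hε hx₀).iter_le (hopt I) (P.nonneg I) hε
    (B := s + q.eval s) ((P.size_Q_le I).trans (by omega)) (fun w hw => (hq I w hw).trans
      ((q.eval_mono_nat (by omega : (P.enc I).size ≤ s)).trans (Nat.le_add_left _ _)))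
  have hmono : MOMILP.solBound d (s + q.eval s) ⌈ε⁻¹⌉₊ ≤ MOMILP.solBound d (s + q.eval s) s := by
    have : ⌈ε⁻¹⌉₊ ≤ s := by omega
    unfold MOMILP.solBound
    gcongr
  refine (h1.trans ?_).trans (hp s)
  dsimp only
  gcongr

theorem allRunsSucceed (hWS : P.IsPolyTimeWS WS) : P.AllRunsSucceed WS := by
  obtain ⟨p, hp⟩ := P.exists_iter_bound hWS
  refine ⟨p, fun I ε hε x₀ hx₀ k S hS => ⟨hp I ε hε x₀ hx₀ k S hS, fun hfin => ?_, fun hfin => ?_⟩⟩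
  · exact (hS.runInv (hWS.1 I) (P.nonneg I) hε hx₀).isConvexApproxSet hfin
  · exact (hS.runInv (hWS.1 I) (P.nonneg I) hε hx₀).exists_step hfin

end MOProblem

/-! ## The search for a violated facet -/

/-- The first value of `φ` on extensions of the list `t` by `j` elements of `G`. -/
def searchTuples {β γ : Type*} (G : List β) (φ : List β → Option γ) : ℕ → List β → Option γ
  | 0, t => φ t
  | j + 1, t => G.findSome? fun g => searchTuples G φ j (g :: t)

section

variable {β γ δ : Type*} {G : List β} {φ : List β → Option γ}

theorem searchTuples_map (f : γ → δ) (j : ℕ) (t : List β) :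
    (searchTuples G φ j t).map f = searchTuples G (fun t => (φ t).map f) j t := by
  induction j generalizing t with
  | zero => rfl
  | succ j ih =>
    simp only [searchTuples, List.map_findSome?, Function.comp_def, ih]

theorem exists_of_searchTuples_eq_some {j : ℕ} {t : List β} {y : γ}
    (h : searchTuples G φ j t = some y) (ht : ∀ g ∈ t, g ∈ G) :
    ∃ u, u.length = j + t.length ∧ (∀ g ∈ u, g ∈ G) ∧ φ u = some y := by
  induction j generalizing t with
  | zero => exact ⟨t, by simp, ht, h⟩
  | succ j ih =>
    obtain ⟨g, hg, h⟩ := List.exists_of_findSome?_eq_some h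
    obtain ⟨u, hu, huG, huy⟩ := ih h (by simpa using ⟨hg, ht⟩)
    exact ⟨u, by rw [hu, List.length_cons]; omega, huG, huy⟩

/-- Tuples grow by prepending, so the chosen elements end up in reverse order. -/
theorem searchTuples_eq_none {j : ℕ} {t : List β} (h : searchTuples G φ j t = none) {u : List β}
    (hu : u.length = j) (huG : ∀ g ∈ u, g ∈ G) : φ (u.reverse ++ t) = none := by
  induction j generalizing t u with
  | zero =>
    obtain rfl := List.length_eq_zero_iff.1 hu
    exact h
  | succ j ih =>
    obtain _ | ⟨g, u⟩ := u
    · simp at hu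
    · rw [searchTuples, List.findSome?_eq_none_iff] at h
      have := ih (h g (huG g List.mem_cons_self)) (u := u) (by simpa using hu)
        fun g' hg' => huG g' (List.mem_cons_of_mem _ hg')
      simpa using this

end

/-- The search is `r` nested loops. As `r` is constant over the family, the nesting depth of the
program is fixed and the polynomial bounds survive. -/
theorem PolyTime.searchTuples {κ β : Type*} {s : κ → ℕ} {a : κ → BData} {e : β → BData}
    {G : κ → List β} {φ : κ → List β → Option BData} {r : ℕ}
    (hG : PolyTime s a fun k => .ofList ((G k).map e))
    (hφ : PolyTime (fun p : {p : κ × List β // p.2.length = r ∧ ∀ g ∈ p.2, g ∈ G p.1} => s p.1.1)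
      (fun p => .pair (.ofList (p.1.2.map e)) (a p.1.1)) fun p => .ofOption (φ p.1.1 p.1.2)) :
    PolyTime s a fun k => .ofOption (searchTuples (G k) (φ k) r []) := by
  -- Induction on the number `j` of loops still to be entered; the partial tuple of length `i`
  -- becomes part of the context of the inner loops.
  have key : ∀ j i, i + j = r →
      PolyTime (fun p : {p : κ × List β // p.2.length = i ∧ ∀ g ∈ p.2, g ∈ G p.1} => s p.1.1)
        (fun p => .pair (.ofList (p.1.2.map e)) (a p.1.1))
        fun p => .ofOption (_root_.searchTuples (G p.1.1) (φ p.1.1) j p.1.2) := by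
    intro j
    induction j with
    | zero => rintro i rfl; exact hφ
    | succ j ih =>
      intro i hij
      have hb : PolyBdd
          (fun p : {p : κ × List β // p.2.length = i ∧ ∀ g ∈ p.2, g ∈ G p.1} => s p.1.1)
          fun p => (BData.pair (.ofList (p.1.2.map e)) (a p.1.1)).size := by
        have hGb := hG.bdd_right.reindex
          fun p : {p : κ × List β // p.2.length = i ∧ ∀ g ∈ p.2, g ∈ G p.1} => p.1.1
        have hab := hG.bdd_left.reindex
          fun p : {p : κ × List β // p.2.length = i ∧ ∀ g ∈ p.2, g ∈ G p.1} => p.1.1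
        refine (((((PolyBdd.const i).mul (hGb.add (PolyBdd.const 1))).add (PolyBdd.const 1)).add
          hab).add (PolyBdd.const 1)).mono fun p => ?_
        have := BData.size_ofList_le (l := p.1.2.map e)
          (B := (BData.ofList ((G p.1.1).map e)).size) fun x hx => by
            obtain ⟨g, hg, rfl⟩ := List.mem_map.1 hx
            exact BData.size_le_size_ofList (List.mem_map_of_mem (p.2.2 g hg))
        rw [List.length_map, p.2.1] at this
        rw [BData.size_pair]
        omega
      refine findSome (e := e) ((refl hb).right.trans (hG.reindex _)) ?_
      have hb' := hb.reindex fun q : {q : {p : κ × List β // p.2.length = i ∧ ∀ g ∈ p.2, g ∈ G p.1} ×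
        β // q.2 ∈ G q.1.1.1} => q.1.1
      have heb : PolyBdd (fun q : {q : {p : κ × List β // p.2.length = i ∧ ∀ g ∈ p.2, g ∈ G p.1} ×
          β // q.2 ∈ G q.1.1.1} => s q.1.1.1.1)
          fun q => (BData.pair (e q.1.2)
            (.pair (.ofList (q.1.1.1.2.map e)) (a q.1.1.1.1))).size := by
        refine (((hG.bdd_right.reindex fun q : {q : {p : κ × List β // p.2.length = i ∧
          ∀ g ∈ p.2, g ∈ G p.1} × β // q.2 ∈ G q.1.1.1} => q.1.1.1.1).add hb').add
          (PolyBdd.const 1)).mono fun q => ?_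
        have := BData.size_le_size_ofList (List.mem_map_of_mem (f := e) q.2)
        rw [BData.size_pair (e _)]
        omega
      have h0 := refl heb
      exact ((h0.left.pair h0.right.left).pair h0.right.right).trans ((ih (i + 1) (by omega)).reindex
        fun q : {q : {p : κ × List β // p.2.length = i ∧ ∀ g ∈ p.2, g ∈ G p.1} ×
          β // q.2 ∈ G q.1.1.1} => ⟨(q.1.1.1.1, q.1.2 :: q.1.1.1.2), by
            simpa using ⟨q.1.1.2.1, q.2, fun g hg => q.1.1.2.2 g hg⟩⟩)
  have ha := hG.bdd_left
  exact ((constInt 0 ha).pair (refl ha)).trans ((key r 0 (zero_add r)).reindex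
    fun k => ⟨(k, []), by simp⟩)

namespace MOMILP

variable {d : ℕ} (M : MOMILP d) (WS : (Fin d → ℚ) → (Fin M.n → ℚ)) (ε : ℚ)

/-- The generators that belong to a list of solutions. -/
def genList (L : List (Fin M.n → ℚ)) : List (Fin (d + 1) → ℤ) :=
  L.map M.homPoint ++ List.ofFn unitDir

/-- The rational weight given by an integral normal vector. -/
def weight (h : Fin (d + 1) → ℤ) : Fin d → ℚ := fun j => (h j.succ : ℚ)

/-- The answer of the oracle for the halfspace with normal vector `h`, in integer arithmetic. -/
def query (h : Fin (d + 1) → ℤ) : Option (Fin M.n → ℚ) :=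
  if -h 0 * ε.den * M.homPoint (WS (weight h)) 0 ≤
      (ε.den + ε.num) * ∑ j : Fin d, h j.succ * M.homPoint (WS (weight h)) j.succ
  then none else some (WS (weight h))

/-- A certificate that the halfspace with normal vector `h` does not contain all generators. -/
def violation (G : List (Fin (d + 1) → ℤ)) (h : Fin (d + 1) → ℤ) : Option BData :=
  G.findSome? fun g => if 0 ≤ h ⬝ᵥ g then none else some (.int 0)

/-- The answer of the oracle, provided that the halfspace with normal vector `h` is valid. -/
def tryNormal (G : List (Fin (d + 1) → ℤ)) (h : Fin (d + 1) → ℤ) : Option (Fin M.n → ℚ) :=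
  if 1 ≤ ∑ j : Fin d, h j.succ then
    if violation G h ≠ none then none else M.query WS ε h
  else none

/-- The normal vector with sign `σ` of the hyperplane spanned by `t`. -/
def tupleNormal (σ : ℤ) (t : List (Fin (d + 1) → ℤ)) : Fin (d + 1) → ℤ :=
  σ • crossVec fun i : Fin d => t.getD i 0

/-- A solution that violates a facet of the polyhedron generated by `G`. -/
def search (G : List (Fin (d + 1) → ℤ)) : Option (Fin M.n → ℚ) :=
  searchTuples G (fun t => [1, -1].findSome? fun σ => M.tryNormal WS ε G (tupleNormal σ t)) d []

variable {M WS ε}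

theorem mem_genList {L : List (Fin M.n → ℚ)} {g : Fin (d + 1) → ℤ} :
    g ∈ M.genList L ↔ g ∈ M.gens L.toFinset := by
  simp [genList, mem_gens]

theorem violation_eq_none {G : List (Fin (d + 1) → ℤ)} {h : Fin (d + 1) → ℤ} :
    violation G h = none ↔ ∀ g ∈ G, 0 ≤ h ⬝ᵥ g := by
  rw [violation, List.findSome?_eq_none_iff]
  exact forall₂_congr fun g _ => by split_ifs <;> simp_all

theorem tryNormal_eq_some {G : List (Fin (d + 1) → ℤ)} {h : Fin (d + 1) → ℤ} {x : Fin M.n → ℚ}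
    (hx : M.tryNormal WS ε G h = some x) :
    1 ≤ ∑ j : Fin d, h j.succ ∧ (∀ g ∈ G, 0 ≤ h ⬝ᵥ g) ∧ M.query WS ε h = some x := by
  unfold tryNormal at hx
  split_ifs at hx with h1 h2
  exact ⟨h1, violation_eq_none.1 (not_not.1 h2), hx⟩

theorem tryNormal_eq {G : List (Fin (d + 1) → ℤ)} {h : Fin (d + 1) → ℤ}
    (h1 : 1 ≤ ∑ j : Fin d, h j.succ) (h2 : ∀ g ∈ G, 0 ≤ h ⬝ᵥ g) :
    M.tryNormal WS ε G h = M.query WS ε h := by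
  rw [tryNormal, if_pos h1, if_neg (not_not.2 (violation_eq_none.2 h2))]

theorem weight_nonneg {G : List (Fin (d + 1) → ℤ)} (hG : ∀ i, unitDir i ∈ G)
    {h : Fin (d + 1) → ℤ} (hh : ∀ g ∈ G, 0 ≤ h ⬝ᵥ g) : 0 ≤ weight h := by
  intro j
  have h1 : (0 : ℝ) ≤ toReal h ⬝ᵥ toReal (unitDir j) := by
    rw [toReal_dotProduct]; exact_mod_cast hh _ (hG j)
  rw [dotProduct_unitDir] at h1
  have h2 : 0 ≤ h j.succ := by simpa [toReal] using h1
  simpa [weight] using h2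

/-- The test of the oracle multiplied by `1+ε`, by the denominator of `ε` and by the common
denominator of the image, all of them positive. -/
theorem query_eq (hε : 0 < ε) (h : Fin (d + 1) → ℤ) :
    M.query WS ε h = M.hpOWS WS (weight h) ((1 + ε)⁻¹ * -(h 0 : ℚ)) := by
  have hε1 : (0 : ℚ) < 1 + ε := by positivity
  set x := WS (weight h) with hx
  have hD : (0 : ℚ) < M.homPoint x 0 := by exact_mod_cast M.homPoint_zero_pos x
  have hden : (0 : ℚ) < ε.den := by exact_mod_cast ε.den_pos
  have hsum : ((∑ j : Fin d, h j.succ * M.homPoint x j.succ : ℤ) : ℚ) =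
      M.homPoint x 0 * (weight h ⬝ᵥ (M.Q *ᵥ x)) := by
    have : (((∑ j : Fin d, h j.succ * M.homPoint x j.succ : ℤ) : ℚ) : ℝ) =
        ((M.homPoint x 0 * (weight h ⬝ᵥ (M.Q *ᵥ x)) : ℚ) : ℝ) := by
      rw [Rat.cast_mul, cast_dotProduct_mulVec]
      push_cast
      simp only [homPoint_succ, dotProduct, castVec, weight, Rat.cast_intCast, Finset.mul_sum]
      exact Finset.sum_congr rfl fun j _ => by ring
    exact_mod_cast this
  have hiff : (-h 0 * ε.den * M.homPoint x 0 ≤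
      (ε.den + ε.num) * ∑ j : Fin d, h j.succ * M.homPoint x j.succ) ↔
      (1 + ε)⁻¹ * -(h 0 : ℚ) ≤ weight h ⬝ᵥ (M.Q *ᵥ x) := by
    rw [← Int.cast_le (R := ℚ), inv_mul_le_iff₀ hε1]
    rw [Int.cast_mul (_ + _), hsum]
    push_cast
    rw [show (ε.num : ℚ) = ε * ε.den from (Rat.mul_den_eq_num _).symm,
      show -(h 0 : ℚ) * ε.den * M.homPoint x 0 = (ε.den * M.homPoint x 0) * -h 0 by ring,
      show ((ε.den : ℚ) + ε * ε.den) * (M.homPoint x 0 * (weight h ⬝ᵥ (M.Q *ᵥ x))) =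
        (ε.den * M.homPoint x 0) * ((1 + ε) * (weight h ⬝ᵥ (M.Q *ᵥ x))) by ring]
    exact mul_le_mul_iff_right₀ (by positivity)
  simp only [query, hpOWS, ← hx, hiff]

theorem castVec_weight (h : Fin (d + 1) → ℤ) :
    castVec (weight h) = Matrix.vecTail (toReal h) := by
  ext i; simp [weight, castVec, toReal, Matrix.vecTail]

theorem homHalfspace_eq_halfspace_smul {q : ℚ} (hq : 0 < q) (h : Fin (d + 1) → ℤ) :
    homHalfspace (toReal h) = halfspace (castVec (q • weight h)) ((q * -(h 0 : ℚ) : ℚ) : ℝ) := by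
  have hqR : (0 : ℝ) < q := by exact_mod_cast hq
  rw [halfspace_eq_homHalfspace, ← homHalfspace_smul hqR, castVec_smul, castVec_weight]
  congr 1
  ext j
  refine Fin.cases ?_ (fun j => ?_) j <;> simp [toReal, Matrix.vecTail]

theorem search_eq_some {L : List (Fin M.n → ℚ)} {x : Fin M.n → ℚ}
    (hx : M.search WS ε (M.genList L) = some x) :
    ∃ σ : ℤ, ∃ T : Fin d → Fin (d + 1) → ℤ, (∀ i, T i ∈ M.gens L.toFinset) ∧
      M.tryNormal WS ε (M.genList L) (σ • crossVec T) = some x := by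
  obtain ⟨t, ht, htG, hx⟩ := exists_of_searchTuples_eq_some hx (by simp)
  obtain ⟨σ, -, hx⟩ := List.exists_of_findSome?_eq_some hx
  refine ⟨σ, _, fun i => mem_genList.1 (htG _ ?_), hx⟩
  have hi : (i : ℕ) < t.length := by rw [ht]; simp
  rw [List.getD_eq_getElem _ _ hi]
  exact List.getElem_mem hi

theorem unitDir_mem_genList (L : List (Fin M.n → ℚ)) (i : Fin d) : unitDir i ∈ M.genList L :=
  mem_genList.2 (M.mem_gens.2 (Or.inr ⟨i, rfl⟩))

theorem search_eq_some_out {L : List (Fin M.n → ℚ)} {x : Fin M.n → ℚ}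
    (hx : M.search WS ε (M.genList L) = some x) : ∃ w, 0 ≤ w ∧ x = WS w := by
  obtain ⟨σ, T, -, hx⟩ := search_eq_some hx
  obtain ⟨-, h2, h3⟩ := tryNormal_eq_some hx
  refine ⟨_, weight_nonneg (unitDir_mem_genList L) h2, ?_⟩
  unfold query at h3
  split_ifs at h3
  exact (Option.some.inj h3).symm

/-- Validity and a nonzero weight make the normal facet-supporting. `F` stays empty, because this
run postpones all accepted halfspaces to its end. -/
theorem search_step (hε : 0 < ε) {L : List (Fin M.n → ℚ)} (hL : L ≠ []) {x : Fin M.n → ℚ}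
    (hx : M.search WS ε (M.genList L) = some x) :
    M.Step (M.hpOWS WS) ε ⟨L.toFinset, ∅⟩ ⟨(x :: L).toFinset, ∅⟩ := by
  obtain ⟨σ, T, hT, hx⟩ := search_eq_some hx
  obtain ⟨h1, h2, h3⟩ := tryNormal_eq_some hx
  set h := σ • crossVec T with hh
  have hne : (M.images L.toFinset).Nonempty := by
    obtain ⟨y, hy⟩ := List.exists_mem_of_ne_nil L hL
    exact M.images_nonempty (List.mem_toFinset.2 hy)
  have hfacet : homHalfspace (toReal h) ∈ facetHalfspaces (M.innerPoly L.toFinset) := by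
    refine (M.isGens_gens L.toFinset).mem_facetHalfspaces hne hT rfl (fun g hg => ?_) fun h0 => ?_
    · rw [toReal_dotProduct]
      exact_mod_cast h2 g (mem_genList.2 hg)
    · have : ∑ j : Fin d, h j.succ = 0 := Finset.sum_eq_zero fun j _ => by
        simpa [toReal, Matrix.vecTail] using congrFun h0 j
      omega
  -- The halfspace is represented with weights scaled by `(1+ε)⁻¹`, so that the factor `1+ε` in the
  -- oracle call cancels and `WS` is called with exactly the integral weight used by `query`.
  have hq : (0 : ℚ) < (1 + ε)⁻¹ := by positivity
  rw [homHalfspace_eq_halfspace_smul hq] at hfacet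
  rw [query_eq hε] at h3
  rw [List.toFinset_cons]
  refine .notInside ⟨hfacet, Set.notMem_empty _⟩ ?_
  rwa [smul_smul, mul_inv_cancel₀ (by positivity), one_smul]

theorem halfspace_ne_univ {w : Fin d → ℝ} (hw : w ≠ 0) (c : ℝ) : halfspace w c ≠ Set.univ := by
  intro h
  have hww : w ⬝ᵥ w ≠ 0 := fun h0 => hw (dotProduct_self_eq_zero.1 h0)
  have : ((c - 1) / (w ⬝ᵥ w)) • w ∈ halfspace w c := h ▸ Set.mem_univ _
  rw [halfspace, Set.mem_ofPred_eq, dotProduct_smul, smul_eq_mul, div_mul_cancel₀ _ hww] at this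
  linarith

/-- Each facet was tried with one particular normal, while `w`, `c` may be another representation.
Optimality of `WS` makes the answer "inside" a statement about the halfspace alone: it contains
`(1+ε) f(x)` for all feasible `x`. -/
theorem search_eq_none (hopt : ∀ w, 0 ≤ w → M.IsWSOptimal w (WS w)) (hε : 0 < ε)
    {L : List (Fin M.n → ℚ)} (hL : L ≠ []) (hx : M.search WS ε (M.genList L) = none)
    {w : Fin d → ℚ} {c : ℚ}
    (hH : halfspace (castVec w) (c : ℝ) ∈ facetHalfspaces (M.innerPoly L.toFinset)) :
    M.hpOWS WS ((1 + ε) • w) c = none := by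
  obtain ⟨y, hy⟩ := List.exists_mem_of_ne_nil L hL
  have hy := List.mem_toFinset.2 hy
  have hne := M.images_nonempty hy
  have hG := M.isGens_gens L.toFinset
  obtain ⟨T, hT, σ, hσ, hHT⟩ := hG.facetHalfspaces_subset hne hH
  set h := σ • crossVec T with hh
  have hw := (halfspace_weight_nonneg hy hH).1
  obtain ⟨w', c', hw', hHw', hP, -⟩ := hH
  rw [innerPoly_eq, hHT] at hP
  have h2 : ∀ g ∈ M.genList L, 0 ≤ h ⬝ᵥ g := fun g hg => by
    have := hG.nonneg_of_subset hne hP g (mem_genList.1 hg)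
    rw [toReal_dotProduct] at this
    exact_mod_cast this
  have hnn := weight_nonneg (unitDir_mem_genList L) h2
  have hnn' : ∀ j : Fin d, 0 ≤ h j.succ := fun j => by simpa [weight] using hnn j
  -- The weights are nonnegative integers, so their sum is positive unless all vanish. In that case
  -- the halfspace would be the whole space, since it contains a point.
  have h1 : 1 ≤ ∑ j : Fin d, h j.succ := by
    by_contra hlt
    have h0 : ∑ j : Fin d, h j.succ = 0 :=
      le_antisymm (by omega) (Finset.sum_nonneg fun j _ => hnn' j)
    have h0' := (Finset.sum_eq_zero_iff_of_nonneg fun j _ => hnn' j).1 h0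
    have htail : Matrix.vecTail (toReal h) = 0 := funext fun j => by
      have := h0' j (Finset.mem_univ j)
      simp [Matrix.vecTail, toReal, this]
    refine halfspace_ne_univ hw' c' ?_
    rw [← hHw', hHT]
    obtain ⟨z, hz⟩ := hne
    have h3 := mem_homHalfspace.1 (hP (subset_upperHull hz))
    refine Set.eq_univ_of_forall fun v => mem_homHalfspace.2 ?_
    rw [dotProduct_vecCons, htail] at h3 ⊢
    simpa using h3
  have hquery : M.query WS ε h = none := by
    rw [← tryNormal_eq h1 h2]
    have h3 := searchTuples_eq_none hx (u := (List.ofFn T).reverse) (by simp)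
      (by simpa [mem_genList] using hT)
    rw [List.reverse_reverse, List.append_nil, List.findSome?_eq_none_iff] at h3
    have h4 := h3 σ (by simpa using hσ)
    have h5 : tupleNormal σ (List.ofFn T) = h := by
      rw [tupleNormal, hh]
      congr 2
      funext i
      simp
    rwa [h5] at h4
  rw [query_eq hε] at hquery
  unfold hpOWS at hquery ⊢
  split_ifs at hquery with hle
  rw [if_pos]
  have hε1 : (0 : ℚ) < 1 + ε := by positivity
  have hε1R : (0 : ℝ) < 1 + (ε : ℝ) := by exact_mod_cast hε1
  set x := WS ((1 + ε) • w)
  have hx := (hopt _ (smul_nonneg hε1.le hw) : M.IsWSOptimal ((1 + ε) • w) x).1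
  have hmem : (1 + ε : ℝ) • M.f (castVec x) ∈ homHalfspace (toReal h) := by
    have h3 := (hopt _ hnn).2 _ hx
    have h4 : (((1 + ε)⁻¹ * -(h 0 : ℚ) : ℚ) : ℝ) ≤
        ((weight h ⬝ᵥ (M.Q *ᵥ WS (weight h)) : ℚ) : ℝ) := by exact_mod_cast hle
    rw [cast_dotProduct_mulVec] at h4
    have h5 := h4.trans h3
    push_cast at h5
    rw [inv_mul_le_iff₀ hε1R, castVec_weight] at h5
    rw [mem_homHalfspace, dotProduct_vecCons, dotProduct_smul, smul_eq_mul]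
    simp only [toReal] at h5 ⊢
    linarith
  rw [← hHT, halfspace, Set.mem_ofPred_eq, dotProduct_smul, smul_eq_mul] at hmem
  have h6 : (c : ℝ) ≤ (((1 + ε) • w ⬝ᵥ (M.Q *ᵥ x) : ℚ) : ℝ) := by
    rw [cast_dotProduct_mulVec, castVec_smul, smul_dotProduct, smul_eq_mul]
    simpa using hmem
  exact_mod_cast h6

end MOMILP

/-! ## The program -/

namespace PolyTime

variable {κ : Type*} {s : κ → ℕ} {a : κ → BData}

theorem ofRat_num {q : κ → ℚ} (h : PolyTime s a fun k => .ofRat (q k)) :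
    PolyTime s a fun k => .int (q k).num := h.left

theorem ofRat_den {q : κ → ℚ} (h : PolyTime s a fun k => .ofRat (q k)) :
    PolyTime s a fun k => .int (q k).den := h.right

theorem of_ofIntVec {n : ℕ} {v : κ → Fin n → ℤ} (h : PolyTime s a fun k => .ofIntVec (v k))
    (i : Fin n) : PolyTime s a fun k => .int (v k i) := of_ofFn h i

theorem ofIntVec {n : ℕ} {v : κ → Fin n → ℤ} (ha : PolyBdd s fun k => (a k).size)
    (h : ∀ i, PolyTime s a fun k => .int (v k i)) : PolyTime s a fun k => .ofIntVec (v k) :=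
  ofFn ha h

theorem crossVec {d : ℕ} {T : κ → Fin d → Fin (d + 1) → ℤ} (ha : PolyBdd s fun k => (a k).size)
    (h : ∀ i j, PolyTime s a fun k => .int (T k i j)) (j : Fin (d + 1)) :
    PolyTime s a fun k => .int (crossVec (T k) j) :=
  (constInt _ ha).mul (det ha fun i j' => h i (j.succAbove j'))

theorem dotProduct {n : ℕ} {u v : κ → Fin n → ℤ} (ha : PolyBdd s fun k => (a k).size)
    (hu : ∀ i, PolyTime s a fun k => .int (u k i)) (hv : ∀ i, PolyTime s a fun k => .int (v k i)) :
    PolyTime s a fun k => .int (u k ⬝ᵥ v k) :=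
  sum _ ha fun i => (hu i).mul (hv i)

theorem _root_.BData.size_int_le {z : ℤ} {E : ℕ} (h : z.natAbs ≤ 2 ^ E) :
    (BData.int z).size ≤ E + 2 := by
  have : z.natAbs < 2 ^ (E + 1) := h.trans_lt (Nat.pow_lt_pow_right (by norm_num) (by omega))
  have := Nat.size_le.2 this
  simp only [BData.size]
  omega

/-- The number of variables depends on the instance, so, unlike in `sum`, a genuine loop is
required; it consumes both vectors as lists. -/
theorem fracSum {n : κ → ℕ} {u v : ∀ k, Fin (n k) → ℚ}
    (hu : PolyTime s a fun k => .ofVec (u k)) (hv : PolyTime s a fun k => .ofVec (v k)) :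
    PolyTime s a fun k => .pair (.int (fracSum (pad (u k)) (pad (v k)) (n k)).1)
      (.int (fracSum (pad (u k)) (pad (v k)) (n k)).2) := by
  have ha := hu.bdd_left
  have hub := hu.bdd_right
  have hvb := hv.bdd_right
  have hn : PolyBdd s n := hub.mono fun k => BData.le_size_ofVec _
  set l : ∀ k, (Fin (n k) → ℚ) → List BData := fun k w => List.ofFn fun i => .ofRat (w i)
  set st : κ → ℕ → BData := fun k i => .pair
    (.pair (.int (_root_.fracSum (pad (u k)) (pad (v k)) i).1)
      (.int (_root_.fracSum (pad (u k)) (pad (v k)) i).2))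
    (.pair (.ofList ((l k (u k)).drop i)) (.ofList ((l k (v k)).drop i))) with hst
  have hstb : PolyBdd (fun p : {p : κ × ℕ // p.2 ≤ n p.1} => s p.1.1)
      fun p => (st p.1.1 p.1.2).size := by
    have hB := (hub.add hvb).reindex fun p : {p : κ × ℕ // p.2 ≤ n p.1} => p.1.1
    refine (((PolyBdd.const 2).mul (((((PolyBdd.const 2).mul hB).add (PolyBdd.const 1)).mul
      (hn.reindex fun p : {p : κ × ℕ // p.2 ≤ n p.1} => p.1.1)).add (PolyBdd.const 2))).add (hB.add (PolyBdd.const 3))).mono ?_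
    rintro ⟨⟨k, i⟩, hi⟩
    dsimp only at hi
    have h1 := fracSum_le (u := pad (u k)) (v := pad (v k)) (i := i)
      (B := (BData.ofVec (u k)).size + (BData.ofVec (v k)).size)
      (fun j hj => (BData.size_pad_le _ (hj.trans_le hi)).trans (Nat.le_add_right _ _))
      (fun j hj => (BData.size_pad_le _ (hj.trans_le hi)).trans (Nat.le_add_left _ _))
    have h2 := BData.size_int_le h1.1
    have h3 := BData.size_int_le h1.2
    have h4 := Nat.mul_le_mul_left
      (2 * ((BData.ofVec (u k)).size + (BData.ofVec (v k)).size) + 1) hi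
    have h5 := BData.size_ofList_drop_le (l k (u k)) i
    have h6 := BData.size_ofList_drop_le (l k (v k)) i
    have h7 : BData.ofVec (u k) = .ofList (l k (u k)) := rfl
    have h8 : BData.ofVec (v k) = .ofList (l k (v k)) := rfl
    simp only [hst, BData.size_pair, h7, h8] at h1 h2 h3 h4 h5 h6 ⊢
    omega
  have hinit : PolyTime s a fun k => st k 0 := by
    exact ((constInt 0 ha).pair (constInt 1 ha)).pair (hu.pair hv)
  refine (hinit.trans (loop (st := st) (N := n) hn ?_ ?_)).left
  · convert (refl hstb).right.left.isPair_ofList using 2 with p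
    simp [BData.bit, List.drop_eq_nil_iff, l]
  · have h := refl (hstb.reindex
      fun p : {p : κ × ℕ // p.2 < n p.1} => ⟨p.1, p.2.le⟩)
    have hdrop : ∀ (k : κ) (w : Fin (n k) → ℚ) (i : ℕ), i < n k →
        BData.ofList ((l k w).drop i) =
          .pair (.ofRat (pad w i)) (.ofList ((l k w).drop (i + 1))) := by
      intro k w i hi
      rw [List.drop_eq_getElem_cons (by simpa [l] using hi)]
      simp [BData.ofList, l, pad, hi]
    have hrest : PolyTime (fun p : {p : κ × ℕ // p.2 < n p.1} => s p.1.1)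
        (fun p => st p.1.1 p.1.2) fun p => .pair
          (.pair (.ofRat (pad (u p.1.1) p.1.2)) (.ofList ((l p.1.1 (u p.1.1)).drop (p.1.2 + 1))))
          (.pair (.ofRat (pad (v p.1.1) p.1.2))
            (.ofList ((l p.1.1 (v p.1.1)).drop (p.1.2 + 1)))) := by
      convert h.right using 2 with p
      simp only [hst, BData.right_pair, hdrop _ _ _ p.2]
    have hN := h.left.left
    have hD := h.left.right
    simp only [hst, BData.left_pair, BData.right_pair] at hN hD
    have hui := hrest.left.left
    have hvi := hrest.right.left
    simp only [BData.left_pair, BData.right_pair] at hui hvi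
    have hdd := hui.ofRat_den.mul hvi.ofRat_den
    exact (((hN.mul hdd).add ((hui.ofRat_num.mul hvi.ofRat_num).mul hD)).pair (hD.mul hdd)).pair
      (hrest.left.right.pair hrest.right.right)

end PolyTime

namespace MOProblem

variable {d : ℕ} {P : MOProblem d} {WS : ∀ I : P.Inst, (Fin d → ℚ) → (Fin (P.toMOMILP I).n → ℚ)}
  {κ : Type*} {s : κ → ℕ} {a : κ → BData} {I : κ → P.Inst}

theorem polyTime_homPoint (hI : PolyTime s a fun k => P.enc (I k))
    {x : ∀ k, Fin (P.toMOMILP (I k)).n → ℚ} (hx : PolyTime s a fun k => .ofVec (x k)) :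
    PolyTime s a fun k => .ofIntVec ((P.toMOMILP (I k)).homPoint (x k)) := by
  have ha := hI.bdd_left
  have hfrac : ∀ j, PolyTime s a fun k => .pair (.int ((P.toMOMILP (I k)).objFrac (x k) j).1)
      (.int ((P.toMOMILP (I k)).objFrac (x k) j).2) := fun j =>
    PolyTime.fracSum (PolyTime.of_ofFn (v := fun k j => BData.ofVec ((P.toMOMILP (I k)).Q j))
      hI.left j) hx
  refine PolyTime.ofIntVec ha fun j => Fin.cases ?_ (fun j => ?_) j
  · exact PolyTime.prod Finset.univ ha fun i => (hfrac i).right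
  · exact (hfrac j).left.mul (PolyTime.prod _ ha fun i => (hfrac i).right)

theorem polyTime_WS (hWS : P.IsPolyTimeWS WS) (hI : PolyTime s a fun k => P.enc (I k))
    {w : κ → Fin d → ℚ} (hw : PolyTime s a fun k => .ofVec (w k)) (hw0 : ∀ k, 0 ≤ w k) :
    PolyTime s a fun k => .ofVec (WS (I k) (w k)) := by
  obtain ⟨-, -, prog, p, h⟩ := hWS
  exact (hI.pair hw).trans (PolyTime.of_bdd ((hI.bdd_right.add hw.bdd_right).eval p)
    fun k => h (I k) (w k) (hw0 k))

theorem polyTime_query (hWS : P.IsPolyTimeWS WS) (hI : PolyTime s a fun k => P.enc (I k))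
    {ε : κ → ℚ} (hε : PolyTime s a fun k => .ofRat (ε k)) {h : κ → Fin (d + 1) → ℤ}
    (hh : ∀ j, PolyTime s a fun k => .int (h k j)) (hw0 : ∀ k, 0 ≤ MOMILP.weight (h k)) :
    PolyTime s a fun k =>
      .ofOption (((P.toMOMILP (I k)).query (WS (I k)) (ε k) (h k)).map BData.ofVec) := by
  have ha := hI.bdd_left
  have hw : PolyTime s a fun k => .ofVec (MOMILP.weight (h k)) :=
    PolyTime.ofFn (v := fun k j => BData.ofRat (MOMILP.weight (h k) j)) ha fun j => by
      simpa [BData.ofRat, MOMILP.weight] using (hh j.succ).pair (PolyTime.constInt 1 ha)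
  have hx := polyTime_WS hWS hI hw hw0
  have hp := polyTime_homPoint hI hx
  have htest := (((((PolyTime.constInt 0 ha).sub (hh 0)).mul hε.ofRat_den).mul
    (hp.of_ofIntVec 0))).le ((hε.ofRat_den.add hε.ofRat_num).mul
      (PolyTime.sum Finset.univ ha fun j : Fin d => (hh j.succ).mul (hp.of_ofIntVec j.succ)))
  simp only [zero_sub] at htest
  refine htest.cond ?_ ?_
  · convert (PolyTime.constInt 0 ha).reindex Subtype.val using 2 with k
    rw [MOMILP.query, if_pos k.2]; rfl
  · convert (hx.pair (PolyTime.constInt 0 ha)).reindex Subtype.val using 2 with k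
    rw [MOMILP.query, if_neg k.2]; rfl

theorem polyTime_violation {G : κ → List (Fin (d + 1) → ℤ)}
    (hG : PolyTime s a fun k => .ofList ((G k).map BData.ofIntVec)) {h : κ → Fin (d + 1) → ℤ}
    (hh : ∀ j, PolyTime s a fun k => .int (h k j)) :
    PolyTime s a fun k => .ofOption (MOMILP.violation (G k) (h k)) := by
  have hb : PolyBdd (fun p : {p : κ × (Fin (d + 1) → ℤ) // p.2 ∈ G p.1} => s p.1.1)
      fun p => (BData.pair (.ofIntVec p.1.2) (a p.1.1)).size := by
    refine (((hG.bdd_right.add hG.bdd_left).add (PolyBdd.const 1)).reindex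
      fun p : {p : κ × (Fin (d + 1) → ℤ) // p.2 ∈ G p.1} => p.1.1).mono fun p => ?_
    have := BData.size_le_size_ofList (List.mem_map_of_mem (f := BData.ofIntVec) p.2)
    rw [BData.size_pair]
    omega
  have h0 := PolyTime.refl hb
  refine PolyTime.findSome hG ((PolyTime.le (PolyTime.constInt 0 hb) (PolyTime.dotProduct hb
    (fun j => h0.right.trans ((hh j).reindex _)) (fun j => h0.left.of_ofIntVec j))).cond ?_ ?_)
  · convert (PolyTime.constInt 0 hb).reindex Subtype.val using 2 with p
    rw [if_pos p.2, BData.ofOption]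
  · convert (PolyTime.constData (.pair (.int 0) (.int 0)) hb).reindex Subtype.val using 2 with p
    rw [if_neg p.2, BData.ofOption]

/-- The time bound of `WS` covers only nonnegative weights. The query therefore sits in the branch
where validity on the unit directions has been checked. -/
theorem polyTime_tryNormal (hWS : P.IsPolyTimeWS WS) (hI : PolyTime s a fun k => P.enc (I k))
    {ε : κ → ℚ} (hε : PolyTime s a fun k => .ofRat (ε k)) {G : κ → List (Fin (d + 1) → ℤ)}
    (hG : PolyTime s a fun k => .ofList ((G k).map BData.ofIntVec)) (hdir : ∀ k i, unitDir i ∈ G k)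
    {h : κ → Fin (d + 1) → ℤ} (hh : ∀ j, PolyTime s a fun k => .int (h k j)) :
    PolyTime s a fun k =>
      .ofOption (((P.toMOMILP (I k)).tryNormal (WS (I k)) (ε k) (G k) (h k)).map BData.ofVec) := by
  have ha := hI.bdd_left
  refine ((PolyTime.constInt 1 ha).le (PolyTime.sum Finset.univ ha fun j : Fin d =>
    hh j.succ)).cond (((polyTime_violation hG hh).isSome_ofOption.reindex Subtype.val).cond ?_ ?_) ?_
  · convert ((PolyTime.constInt 0 ha).reindex Subtype.val).reindex Subtype.val using 2 with k
    rw [MOMILP.tryNormal, if_pos k.1.2, if_pos k.2]; rfl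
  · convert polyTime_query hWS ((hI.reindex Subtype.val).reindex Subtype.val)
      ((hε.reindex Subtype.val).reindex Subtype.val)
      (fun j => ((hh j).reindex Subtype.val).reindex Subtype.val) (fun k => ?_) using 2 with k
    · rw [MOMILP.tryNormal, if_pos k.1.2, if_neg k.2]
    · exact MOMILP.weight_nonneg (hdir _) (MOMILP.violation_eq_none.1 (not_not.1 k.2))
  · convert (PolyTime.constInt 0 ha).reindex Subtype.val using 2 with k
    rw [MOMILP.tryNormal, if_neg k.2]; rfl

theorem polyTime_search (hWS : P.IsPolyTimeWS WS) (hI : PolyTime s a fun k => P.enc (I k))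
    {ε : κ → ℚ} (hε : PolyTime s a fun k => .ofRat (ε k)) {G : κ → List (Fin (d + 1) → ℤ)}
    (hG : PolyTime s a fun k => .ofList ((G k).map BData.ofIntVec))
    (hdir : ∀ k i, unitDir i ∈ G k) :
    PolyTime s a fun k =>
      .ofOption (((P.toMOMILP (I k)).search (WS (I k)) (ε k) (G k)).map BData.ofVec) := by
  simp only [MOMILP.search, searchTuples_map, List.map_findSome?]
  refine PolyTime.searchTuples hG ?_
  set Λ := {p : κ × List (Fin (d + 1) → ℤ) // p.2.length = d ∧ ∀ g ∈ p.2, g ∈ G p.1}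
  have hb : PolyBdd (fun p : Λ => s p.1.1)
      fun p => (BData.pair (.ofList (p.1.2.map BData.ofIntVec)) (a p.1.1)).size := by
    refine ((((PolyBdd.const d).mul (hG.bdd_right.add (PolyBdd.const 1))).add
      (hG.bdd_left.add (PolyBdd.const 2))).reindex fun p : Λ => p.1.1).mono fun p => ?_
    have := BData.size_ofList_le (l := p.1.2.map BData.ofIntVec)
      (B := (BData.ofList ((G p.1.1).map BData.ofIntVec)).size) fun x hx => by
        obtain ⟨g, hg, rfl⟩ := List.mem_map.1 hx
        exact BData.size_le_size_ofList (List.mem_map_of_mem (p.2.2 g hg))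
    rw [List.length_map, p.2.1] at this
    rw [BData.size_pair]
    omega
  refine PolyTime.findSome (e := BData.int)
    (PolyTime.constData (.ofList ([1, -1].map BData.int)) hb) ?_
  set Λ' := {q : Λ × ℤ // q.2 ∈ ([1, -1] : List ℤ)}
  have hb' : PolyBdd (fun q : Λ' => s q.1.1.1.1) fun q => (BData.pair (.int q.1.2)
      (.pair (.ofList (q.1.1.1.2.map BData.ofIntVec)) (a q.1.1.1.1))).size := by
    refine ((hb.add (PolyBdd.const 3)).reindex fun q : Λ' => q.1.1).mono fun q => ?_
    have : (BData.int q.1.2).size = 2 := by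
      have := q.2
      simp only [List.mem_cons, List.not_mem_nil, or_false] at this
      rcases this with h | h <;> rw [h] <;> rfl
    rw [BData.size_pair (.int _), this]
    omega
  have h0 := PolyTime.refl hb'
  have hctx : PolyTime (fun q : Λ' => s q.1.1.1.1) _ fun q => a q.1.1.1.1 := h0.right.right
  refine polyTime_tryNormal (I := fun q : Λ' => I q.1.1.1.1) hWS (hctx.trans (hI.reindex _))
    (hctx.trans (hε.reindex _)) (hctx.trans (hG.reindex _)) (fun q => hdir _) fun j => ?_
  refine PolyTime.mul h0.left (PolyTime.crossVec hb' (fun i j => ?_) j)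
  refine PolyTime.of_ofIntVec ?_ j
  convert h0.right.left.getD_ofList (i : ℕ) using 2 with q
  have hi : (i : ℕ) < q.1.1.1.2.length := by rw [q.1.1.2.1]; exact i.2
  simp [hi]

end MOProblem

/-! ## The complete algorithm -/

namespace MOMILP

variable {d : ℕ} (M : MOMILP d) (WS : (Fin d → ℚ) → (Fin M.n → ℚ)) (ε : ℚ)

/-- The solutions found after `i` successful searches, beginning with an optimal solution for the
weight `0`. -/
def solList : ℕ → List (Fin M.n → ℚ)
  | 0 => [WS 0]
  | i + 1 => match M.search WS ε (M.genList (solList i)) with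
    | none => solList i
    | some x => x :: solList i

variable {M WS ε}

theorem solList_succ {i : ℕ} {x : Fin M.n → ℚ}
    (h : M.search WS ε (M.genList (M.solList WS ε i)) = some x) :
    M.solList WS ε (i + 1) = x :: M.solList WS ε i := by
  rw [solList, h]

theorem solList_succ_cases (i : ℕ) : M.solList WS ε (i + 1) = M.solList WS ε i ∨
    ∃ x, M.search WS ε (M.genList (M.solList WS ε i)) = some x ∧
      M.solList WS ε (i + 1) = x :: M.solList WS ε i := by
  rcases h : M.search WS ε (M.genList (M.solList WS ε i)) with _ | x
  · left; rw [solList, h]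
  · exact Or.inr ⟨x, rfl, solList_succ h⟩

theorem solList_ne_nil (i : ℕ) : M.solList WS ε i ≠ [] := by
  induction i with
  | zero => simp [solList]
  | succ i ih =>
    rcases solList_succ_cases (M := M) (WS := WS) (ε := ε) i with h | ⟨x, -, h⟩ <;> simp [h, ih]

theorem length_solList_le (i : ℕ) : (M.solList WS ε i).length ≤ i + 1 := by
  induction i with
  | zero => simp [solList]
  | succ i ih =>
    rcases solList_succ_cases (M := M) (WS := WS) (ε := ε) i with h | ⟨x, -, h⟩
    · rw [h]; omega
    · rw [h, List.length_cons]; omega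

theorem mem_solList {i : ℕ} {x : Fin M.n → ℚ} (hx : x ∈ M.solList WS ε i) :
    ∃ w, 0 ≤ w ∧ x = WS w := by
  induction i with
  | zero => exact ⟨0, le_rfl, by simpa [solList] using hx⟩
  | succ i ih =>
    rcases solList_succ_cases (M := M) (WS := WS) (ε := ε) i with h | ⟨y, hy, h⟩
    · exact ih (h ▸ hx)
    · rw [h, List.mem_cons] at hx
      rcases hx with rfl | hx
      · exact search_eq_some_out hy
      · exact ih hx

theorem reaches_solList (hε : 0 < ε) {i : ℕ}
    (h : ∀ j < i, M.search WS ε (M.genList (M.solList WS ε j)) ≠ none) :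
    M.Reaches (M.hpOWS WS) ε (WS 0) i ⟨(M.solList WS ε i).toFinset, ∅⟩ := by
  induction i with
  | zero => simpa [solList] using Reaches.init
  | succ i ih =>
    obtain ⟨x, hx⟩ := Option.ne_none_iff_exists'.1 (h i (Nat.lt_succ_self i))
    rw [solList_succ hx]
    exact .step (ih fun j hj => h j (hj.trans (Nat.lt_succ_self i)))
      (search_step hε (solList_ne_nil i) hx)

/-- If the oracle answers "inside" for all facets, then the algorithm ends without a change of the
set of solutions. -/
theorem Reaches.exists_isFinal {x₀ : Fin M.n → ℚ}
    {hpO : (Fin d → ℚ) → ℚ → Option (Fin M.n → ℚ)} {b : ℕ}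
    (hb : ∀ k S, M.Reaches hpO ε x₀ k S → k ≤ b)
    (hstep : ∀ k S, M.Reaches hpO ε x₀ k S → ¬ S.IsFinal → ∃ S', M.Step hpO ε S S')
    {k : ℕ} {S : M.State} (hS : M.Reaches hpO ε x₀ k S)
    (hin : ∀ (w : Fin d → ℚ) (c : ℚ), halfspace (castVec w) (c : ℝ) ∈
      facetHalfspaces (M.innerPoly S.R) → hpO ((1 + ε) • w) c = none) :
    ∃ k' S', M.Reaches hpO ε x₀ k' S' ∧ S'.IsFinal ∧ S'.R = S.R := by
  obtain ⟨n, hn⟩ : ∃ n, b < k + n := ⟨b + 1, by omega⟩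
  induction n generalizing k S with
  | zero => exact absurd (hb k S hS) (by omega)
  | succ n ih =>
    by_cases hfin : S.IsFinal
    · exact ⟨k, S, hS, hfin, rfl⟩
    · obtain ⟨S', hS'⟩ := hstep k S hS hfin
      have hreach := hS.step hS'
      cases hS' with
      | notInside hH hx => rw [hin _ _ hH.1] at hx; cases hx
      | inside hH hx =>
        have hn' : b < k + 1 + n := by omega
        have := ih hreach hin hn'
        exact this

end MOMILP

/-! ### Running time of the complete algorithm -/

namespace MOProblem

variable {d : ℕ} {P : MOProblem d} {WS : ∀ I : P.Inst, (Fin d → ℚ) → (Fin (P.toMOMILP I).n → ℚ)}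

/-- Successful searches are iterations of a run, so they cannot outnumber the iteration bound. -/
theorem exists_search_eq_none (hWS : P.IsPolyTimeWS WS) :
    ∃ p : Polynomial ℕ, ∀ (I : P.Inst) (ε : ℚ), 0 < ε → ∃ N ≤ p.eval ((P.enc I).size + ⌈ε⁻¹⌉₊),
      (P.toMOMILP I).search (WS I) ε
        ((P.toMOMILP I).genList ((P.toMOMILP I).solList (WS I) ε N)) = none := by
  obtain ⟨p, hp⟩ := P.exists_iter_bound hWS
  refine ⟨p, fun I ε hε => ?_⟩
  by_contra! hcon
  have h := hp I ε hε _ (hWS.1 I 0 le_rfl).1 _ _ (MOMILP.reaches_solList (WS := WS I) hε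
    (i := p.eval ((P.enc I).size + ⌈ε⁻¹⌉₊) + 1) fun j hj => hcon j (by omega))
  omega

theorem exists_final_solList (hWS : P.IsPolyTimeWS WS) (I : P.Inst) {ε : ℚ} (hε : 0 < ε) {N : ℕ}
    (hN : (P.toMOMILP I).search (WS I) ε
      ((P.toMOMILP I).genList ((P.toMOMILP I).solList (WS I) ε N)) = none)
    (hlt : ∀ j < N, (P.toMOMILP I).search (WS I) ε
      ((P.toMOMILP I).genList ((P.toMOMILP I).solList (WS I) ε j)) ≠ none) :
    ∃ k S, (P.toMOMILP I).Reaches ((P.toMOMILP I).hpOWS (WS I)) ε (WS I 0) k S ∧ S.IsFinal ∧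
      S.R = ((P.toMOMILP I).solList (WS I) ε N).toFinset := by
  obtain ⟨p, hp⟩ := P.exists_iter_bound hWS
  have h0 := (hWS.1 I 0 le_rfl).1
  exact (MOMILP.reaches_solList hε hlt).exists_isFinal (hp I ε hε _ h0)
    (fun k S hS => (hS.runInv (hWS.1 I) (P.nonneg I) hε h0).exists_step)
    fun w c => MOMILP.search_eq_none (hWS.1 I) hε (MOMILP.solList_ne_nil N) hN

/-- The size bound is read off from the polynomial-time computation, with all pairs of an instance
and a vector as the index family. -/
theorem exists_size_homPoint_le (P : MOProblem d) : ∃ p : Polynomial ℕ,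
    ∀ (I : P.Inst) (x : Fin (P.toMOMILP I).n → ℚ),
      (BData.ofIntVec ((P.toMOMILP I).homPoint x)).size ≤
        p.eval ((P.enc I).size + (BData.ofVec x).size + 1) := by
  have h := PolyTime.refl (κ := Σ I : P.Inst, (Fin (P.toMOMILP I).n → ℚ))
    (a := fun y => .pair (P.enc y.1) (BData.ofVec y.2)) PolyBdd.self
  obtain ⟨p, hp⟩ := (polyTime_homPoint h.left h.right).bdd_right
  exact ⟨p, fun I x => hp ⟨I, x⟩⟩

/-- The run of the algorithm with the successive searches is computable in polynomial time. -/
theorem polyTime_solList (hWS : P.IsPolyTimeWS WS) {κ : Type*} {s : κ → ℕ} {I : κ → P.Inst}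
    {ε : κ → ℚ} (hs : PolyBdd s fun k => (BData.pair (P.enc (I k)) (.ofRat (ε k))).size)
    {N : κ → ℕ} (hNb : PolyBdd s N)
    (hN : ∀ k, (P.toMOMILP (I k)).search (WS (I k)) (ε k)
      ((P.toMOMILP (I k)).genList ((P.toMOMILP (I k)).solList (WS (I k)) (ε k) (N k))) = none)
    (hlt : ∀ k, ∀ j < N k, (P.toMOMILP (I k)).search (WS (I k)) (ε k)
      ((P.toMOMILP (I k)).genList ((P.toMOMILP (I k)).solList (WS (I k)) (ε k) j)) ≠ none) :
    PolyTime s (fun k => .pair (P.enc (I k)) (.ofRat (ε k))) fun k =>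
      .ofList (((P.toMOMILP (I k)).solList (WS (I k)) (ε k) (N k)).map BData.ofVec) := by
  set L := fun k i => (P.toMOMILP (I k)).solList (WS (I k)) (ε k) i with hL
  set G := fun k i => (P.toMOMILP (I k)).genList (L k i) with hG
  set st : κ → ℕ → BData := fun k i => .pair (.pair (.ofList ((L k i).map BData.ofVec))
    (.ofList ((G k i).map BData.ofIntVec))) (.pair (P.enc (I k)) (.ofRat (ε k))) with hst
  have henc : PolyBdd s fun k => (P.enc (I k)).size := hs.mono fun k => by
    rw [BData.size_pair]; omega
  obtain ⟨q, hq⟩ := hWS.2.1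
  obtain ⟨r, hr⟩ := exists_size_homPoint_le P
  -- Every stored solution is an output of `WS`, whose length is bounded in terms of the instance
  -- alone. Without this, lengths could compound from one iteration to the next through the weights.
  have hstb : PolyBdd (fun p : {p : κ × ℕ // p.2 ≤ N p.1} => s p.1.1)
      fun p => (st p.1.1 p.1.2).size := by
    set C := (BData.ofList ((List.ofFn (unitDir (d := d))).map BData.ofIntVec)).size with hC
    set E : κ → ℕ := fun k => q.eval (P.enc (I k)).size with hE
    set F : κ → ℕ := fun k => r.eval ((P.enc (I k)).size + E k + 1) with hF
    have hEb : PolyBdd s E := henc.eval q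
    have hFb : PolyBdd s F := ((henc.add hEb).add (PolyBdd.const 1)).eval r
    have hN1 := hNb.add (PolyBdd.const 1)
    have hN2 := hNb.add (PolyBdd.const (1 + d))
    have hEF := (hEb.add hFb).add (PolyBdd.const (C + 1))
    refine (((((hN1.mul hEF).add (hN2.mul hEF)).add hs).add (PolyBdd.const 4)).reindex
      fun p : {p : κ × ℕ // p.2 ≤ N p.1} => p.1.1).mono ?_
    rintro ⟨⟨k, i⟩, hi⟩
    dsimp only at hi ⊢
    have hlen : (L k i).length ≤ N k + 1 := (MOMILP.length_solList_le i).trans (by omega)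
    have hsol : ∀ x ∈ L k i, (BData.ofVec x).size ≤ E k := fun x hx => by
      obtain ⟨w, hw, rfl⟩ := MOMILP.mem_solList hx
      exact hq (I k) w hw
    have h1 := BData.size_ofList_le (l := (L k i).map BData.ofVec) (B := E k + F k + C) fun y hy => by
      obtain ⟨x, hx, rfl⟩ := List.mem_map.1 hy
      exact (hsol x hx).trans (by omega)
    have h2 := BData.size_ofList_le (l := (G k i).map BData.ofIntVec) (B := E k + F k + C)
      fun y hy => by
        obtain ⟨g, hg, rfl⟩ := List.mem_map.1 hy
        rcases List.mem_append.1 hg with hg | hg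
        · obtain ⟨x, hx, rfl⟩ := List.mem_map.1 hg
          have h3 : (BData.ofIntVec ((P.toMOMILP (I k)).homPoint x)).size ≤ F k :=
            (hr (I k) x).trans (r.eval_mono_nat (by have := hsol x hx; omega))
          omega
        · have := BData.size_le_size_ofList (List.mem_map_of_mem (f := BData.ofIntVec) hg)
          omega
    rw [List.length_map] at h1 h2
    have hlenG : (G k i).length ≤ N k + (1 + d) := by
      simp only [hG, MOMILP.genList, List.length_append, List.length_map, List.length_ofFn]
      omega
    have h4 := Nat.mul_le_mul_right (E k + F k + C + 1) hlen
    have h5 := Nat.mul_le_mul_right (E k + F k + C + 1) hlenG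
    have h6 : E k + F k + (C + 1) = E k + F k + C + 1 := by omega
    rw [h6]
    simp only [hst]
    rw [BData.size_pair (BData.pair _ _) (BData.pair _ _), BData.size_pair (BData.ofList _)]
    omega
  have hsearch := polyTime_search (I := fun p : {p : κ × ℕ // p.2 ≤ N p.1} => I p.1.1)
    (ε := fun p => ε p.1.1) (G := fun p => G p.1.1 p.1.2) hWS (PolyTime.refl hstb).right.left
    (PolyTime.refl hstb).right.right (PolyTime.refl hstb).left.right
    fun p i => MOMILP.unitDir_mem_genList _ i
  have h0 := PolyTime.refl hs
  have hx₀ := polyTime_WS (w := fun _ => 0) hWS h0.left (PolyTime.constData _ hs) fun _ => le_rfl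
  have hinit : PolyTime s (fun k => .pair (P.enc (I k)) (.ofRat (ε k))) fun k => st k 0 := by
    refine ((hx₀.pair (PolyTime.constInt 0 hs)).pair ((polyTime_homPoint h0.left hx₀).pair
      (PolyTime.constData (.ofList ((List.ofFn unitDir).map BData.ofIntVec)) hs))).pair h0
  refine (hinit.trans (PolyTime.loop (st := st) (N := N) hNb ?_ ?_)).left.left
  -- The loop condition is the success of the search itself; by the choice of `N` it holds exactly
  -- at the indices below `N`.
  · convert hsearch.isSome_ofOption using 2 with p
    have hiff : p.1.2 < N p.1.1 ↔ (P.toMOMILP (I p.1.1)).search (WS (I p.1.1)) (ε p.1.1)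
        (G p.1.1 p.1.2) ≠ none := by
      refine ⟨hlt p.1.1 p.1.2, fun h => lt_of_le_of_ne p.2 fun h' => h ?_⟩
      rw [h']
      exact hN p.1.1
    simp [BData.bit, hiff]
  · set ψ : {p : κ × ℕ // p.2 < N p.1} → {p : κ × ℕ // p.2 ≤ N p.1} := fun p => ⟨p.1, p.2.le⟩
    have h1 := (PolyTime.refl hstb).reindex ψ
    have hsome : ∀ p : {p : κ × ℕ // p.2 < N p.1}, ∃ x, (P.toMOMILP (I p.1.1)).search
        (WS (I p.1.1)) (ε p.1.1) (G p.1.1 p.1.2) = some x := fun p =>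
      Option.ne_none_iff_exists'.1 (hlt p.1.1 p.1.2 p.2)
    choose x hx using hsome
    have hnew : PolyTime (fun p : {p : κ × ℕ // p.2 < N p.1} => s p.1.1)
        (fun p => st p.1.1 p.1.2) fun p => .ofVec (x p) := by
      convert (hsearch.reindex ψ).left using 2 with p
      simp [ψ, hx p, BData.ofOption]
    have hhom := polyTime_homPoint (I := fun p : {p : κ × ℕ // p.2 < N p.1} => I p.1.1)
      h1.right.left hnew
    convert ((hnew.pair h1.left.left).pair (hhom.pair h1.left.right)).pair h1.right using 2 with p
    have hsucc : L p.1.1 (p.1.2 + 1) = x p :: L p.1.1 p.1.2 := MOMILP.solList_succ (hx p)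
    simp only [hst, hG, hsucc]
    rfl

theorem exists_program (hWS : P.IsPolyTimeWS WS) :
    ∃ (alg : Prog) (p : Polynomial ℕ), ∀ (I : P.Inst) (ε : ℚ), 0 < ε →
      ∃ (L : List (Fin (P.toMOMILP I).n → ℚ)) (k : ℕ) (S : (P.toMOMILP I).State),
        (P.toMOMILP I).Reaches ((P.toMOMILP I).hpOWS (WS I)) ε (WS I 0) k S ∧ S.IsFinal ∧
        S.R = L.toFinset ∧
        alg.RunsWithin (.pair (P.enc I) (BData.ofRat ε)) (BData.ofList (L.map BData.ofVec))
          (p.eval ((P.enc I).size + (BData.ofRat ε).size + ⌈ε⁻¹⌉₊)) := by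
  classical
  obtain ⟨p, hp⟩ := exists_search_eq_none hWS
  have hex : ∀ k : {y : P.Inst × ℚ // 0 < y.2}, ∃ N, (P.toMOMILP k.1.1).search (WS k.1.1) k.1.2
      ((P.toMOMILP k.1.1).genList ((P.toMOMILP k.1.1).solList (WS k.1.1) k.1.2 N)) = none :=
    fun k => let ⟨N, _, hN⟩ := hp k.1.1 k.1.2 k.2; ⟨N, hN⟩
  have hle : ∀ k, Nat.find (hex k) ≤ p.eval ((P.enc k.1.1).size + ⌈k.1.2⁻¹⌉₊) := fun k => by
    obtain ⟨N, hN, hN'⟩ := hp k.1.1 k.1.2 k.2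
    exact (Nat.find_min' (hex k) hN').trans hN
  obtain ⟨alg, r, h⟩ := polyTime_solList (κ := {y : P.Inst × ℚ // 0 < y.2})
    (s := fun k => (P.enc k.1.1).size + (BData.ofRat k.1.2).size + ⌈k.1.2⁻¹⌉₊)
    (I := fun k => k.1.1) (ε := fun k => k.1.2) hWS
    ((PolyBdd.self.add (PolyBdd.const 1)).mono fun k => by rw [BData.size_pair]; omega)
    (N := fun k => Nat.find (hex k))
    ((PolyBdd.self.eval p).mono fun k => (hle k).trans (p.eval_mono_nat (by omega)))
    (fun k => Nat.find_spec (hex k)) (fun k j hj => Nat.find_min (hex k) hj)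
  refine ⟨alg, r, fun I ε hε => ?_⟩
  obtain ⟨k, S, hS⟩ := exists_final_solList hWS I hε (Nat.find_spec (hex ⟨(I, ε), hε⟩))
    fun j hj => Nat.find_min (hex ⟨(I, ε), hε⟩) hj
  exact ⟨_, k, S, hS.1, hS.2.1, hS.2.2, h ⟨(I, ε), hε⟩⟩

end MOProblem

theorem mainTheorem5 {d : ℕ} (hd : 0 < d) (P : MOProblem d)
    (WS : ∀ I : P.Inst, (Fin d → ℚ) → (Fin (P.toMOMILP I).n → ℚ))
    (hWS : P.IsPolyTimeWS WS) :
    P.AllRunsSucceed WS ∧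
      ∃ alg : Prog, P.ImplementsInnerApprox WS alg ∧ P.IsCFPTAS alg := by
  refine ⟨P.allRunsSucceed hWS, ?_⟩
  obtain ⟨alg, p, h⟩ := MOProblem.exists_program hWS
  refine ⟨alg, fun I ε hε => ?_, p, fun I ε hε => ?_⟩
  · obtain ⟨L, k, S, hS, hfin, hL, t, -, hrun⟩ := h I ε hε
    exact ⟨WS I 0, k, S, L, t, (hWS.1 I 0 le_rfl).1, hS, hfin, fun x => by simp [hL], hrun⟩
  · obtain ⟨L, k, S, hS, hfin, hL, hrun⟩ := h I ε hε
    refine ⟨L, ?_, hrun⟩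
    have := (hS.runInv (hWS.1 I) (P.nonneg I) hε (hWS.1 I 0 le_rfl).1).isConvexApproxSet hfin
    simpa [hL] using this
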